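/- Let $p$ be a prime and $n \ge 0$ an integer, and let $P_n$ be a Sylow $p$-subgroup of the symmetric group $S_{p^n}$. Then the $p$-group $P_n$ has the Maschke property. That is, whenever a finite group $G$ of order prime to $p$ acts on $P_n$ by automorphisms, and $N$ is a $G$-invariant normal subgroup of $P_n$ which has a complement in $P_n$ (a subgroup $L$ with $NL = P_n$ and $N \cap L = 1$), then $N$ has a $G$-invariant complement in $P_n$. -/

import Mathlib

universe w u

/-- A finite group `G` is a `π`-group if every prime dividing its order lies in `π`.
A `π'`-group is a `πᶜ`-group in this sense. -/
def IsPiGroup (π : Set ℕ) (G : Type*) [Group G] : Prop :=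
  Finite G ∧ ∀ q : ℕ, q.Prime → q ∣ Nat.card G → q ∈ π

/-- The subgroup `N` of `V` is invariant under the action `φ` of `G` on `V` by automorphisms. -/
def IsInvariantSubgroup {G V : Type*} [Group G] [Group V] (φ : G →* MulAut V)
    (N : Subgroup V) : Prop :=
  ∀ g : G, ∀ x ∈ N, φ g x ∈ N

/-- A `π`-group `V` has the Maschke property if, whenever a `π'`-group `G` acts on `V` by
automorphisms, every `G`-invariant normal subgroup of `V` that has a complement in `V` also has a
`G`-invariant complement in `V`. The universe `w` of the acting groups is arbitrary. -/
def HasMaschkeProperty (π : Set ℕ) (V : Type u) [Group V] : Prop :=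
  IsPiGroup π V ∧
    ∀ (G : Type w) [Group G] (φ : G →* MulAut V), IsPiGroup πᶜ G →
      ∀ N : Subgroup V, N.Normal → IsInvariantSubgroup φ N →
        (∃ L : Subgroup V, N.IsComplement' L) →
          ∃ C : Subgroup V, IsInvariantSubgroup φ C ∧ N.IsComplement' C

/-!
A Sylow `p`-subgroup of the symmetric group on `p ^ n` points is an iterated wreath product of
cyclic groups of order `p`. It is realized here as the group `treeGroup p n` of those permutations
of the words of length `n` over `ZMod p` that add to each letter an amount, its *label*, depending
only on the earlier letters. The stabilizers `level p n k` of the prefixes of length `k` form a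
chain of normal subgroups, and `level p n k` is a direct power of `treeGroup p (n - k)`, with one
factor for each word of length `k`.

**Actions.** A `p'`-group `G` of automorphisms preserves each `level p n k` (`smul_level_eq`): for
odd `p` it is the largest normal subgroup that is abelian modulo `level p n (k + 1)`, and for
`p = 2` there is at most one other candidate for its image, so that a group of odd order cannot move it.
An automorphism preserving the stabilizers acts by scalars on the `n` factors of the abelianization
`(F_p)^n` that are given by the depths. The kernel of the resulting homomorphism to the torus
`(F_p^×)^n` is a `p`-group (`isPGroup_ker_diagPart`), and the torus itself acts on `treeGroup p n`
by scaling letters. As `G` is a `p'`-group, its action is conjugate to one through the torus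
(`exists_conj_torus`), by the vanishing of the first cohomology with values in a `p`-group.

**Normal subgroups.** Let `N` be nontrivial and normal, and let `k` be maximal with
`N ≤ level p n k`. Then `N` contains the commutator subgroup of `level p n k` (`commute_map_of_mem_level`,
`map_eq_one_of_blockSum`), so that it is given by a submodule of the abelianization of
`level p n k`. This is the module of functions from the words of length `k` to `E = (F_p)^{n-k}`, and the
coordinates of the abelianization are the sums of the labels of fixed depth below a fixed word of
length `k`. If `N` has a complement `L`, then `L ⊓ level p n k` gives a complementary submodule.
Looking at fixed points shows that every complement `F` in `E` to the subspace `E₁` of the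
constants of `N` gives a complementary submodule, the functions with values in `F`
(`isCompl_valuedIn`).

**Lifting.** It remains to choose `F` invariant under the torus action and such that it lifts to
`treeGroup p (n - k)`. Elements of order `p` with a nonzero label at the root have vanishing sums
of the deeper labels (`blockSum_eq_zero_of_pow_eq_one`). Hence the constants of `L ⊓ level p n k`
either form the line of the coordinate at depth `k`, which lifts to rotations, or are contained in
the hyperplane where this coordinate vanishes. In the second case Maschke's theorem gives an
invariant `F` in that hyperplane, which lifts to products of commuting rotations (`comb`).
-/

open Equiv

namespace TreeGroup

/-! ### Words and prefixes -/

/-- Two words agree on their first `k` letters. -/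
def AgreeTo {p n : ℕ} (k : ℕ) (x y : Fin n → ZMod p) : Prop :=
  ∀ j : Fin n, (j : ℕ) < k → x j = y j

namespace AgreeTo

variable {p n k l : ℕ} {x y z : Fin n → ZMod p}

theorem refl (k : ℕ) (x : Fin n → ZMod p) : AgreeTo k x x := fun _ _ => rfl

theorem symm (h : AgreeTo k x y) : AgreeTo k y x := fun j hj => (h j hj).symm

theorem trans (h : AgreeTo k x y) (h' : AgreeTo k y z) : AgreeTo k x z :=
  fun j hj => (h j hj).trans (h' j hj)

theorem mono (h : AgreeTo k x y) (hl : l ≤ k) : AgreeTo l x y :=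
  fun j hj => h j (hj.trans_le hl)

theorem eq (h : AgreeTo n x y) : x = y := funext fun j => h j j.2

end AgreeTo

/-- Replace all letters of a word from position `k` on by `0`. -/
def trunc {p n : ℕ} (k : ℕ) (x : Fin n → ZMod p) : Fin n → ZMod p :=
  fun j => if (j : ℕ) < k then x j else 0

section trunc

variable {p n k : ℕ} {x y : Fin n → ZMod p}

theorem agreeTo_trunc (k : ℕ) (x : Fin n → ZMod p) : AgreeTo k (trunc k x) x :=
  fun j hj => by simp [trunc, hj]

theorem trunc_apply_of_le {j : Fin n} (hj : k ≤ j) (x : Fin n → ZMod p) : trunc k x j = 0 := by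
  simp [trunc, hj]

theorem trunc_eq_iff : trunc k x = trunc k y ↔ AgreeTo k x y := by
  refine ⟨fun h => (agreeTo_trunc k x).symm.trans (h ▸ agreeTo_trunc k y), fun h => ?_⟩
  funext j
  by_cases hj : (j : ℕ) < k
  · simp [trunc, hj, h j hj]
  · simp [trunc, hj]

theorem trunc_eq_self (h : ∀ j : Fin n, k ≤ j → x j = 0) : trunc k x = x := by
  funext j
  by_cases hj : (j : ℕ) < k
  · simp [trunc, hj]
  · simp [trunc, hj, h j (not_lt.mp hj)]

theorem trunc_trunc (k : ℕ) (x : Fin n → ZMod p) : trunc k (trunc k x) = trunc k x :=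
  trunc_eq_iff.2 (agreeTo_trunc k x)

end trunc

/-! ### The iterated wreath product as a group of permutations of words -/

theorem agreeTo_apply_of_label {p n : ℕ} {σ : Perm (Fin n → ZMod p)}
    (hσ : ∀ (i : Fin n) x y, AgreeTo i x y → σ x i - x i = σ y i - y i) {k : ℕ}
    {x y : Fin n → ZMod p} : AgreeTo k (σ x) (σ y) ↔ AgreeTo k x y := by
  have key : ∀ {k : ℕ} {x y : Fin n → ZMod p}, AgreeTo k x y → AgreeTo k (σ x) (σ y) := by
    intro k x y h j hj
    have := hσ j x y (h.mono hj.le)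
    rw [h j hj] at this
    exact sub_left_injective this
  refine ⟨fun h => ?_, key⟩
  induction k with
  | zero => exact fun j hj => absurd hj (Nat.not_lt_zero _)
  | succ k ih =>
    have hk := ih (h.mono k.le_succ)
    intro j hj
    rcases Nat.lt_succ_iff_lt_or_eq.1 hj with hj' | hj'
    · exact hk j hj'
    · have := hσ j x y (hj' ▸ hk)
      rw [h j hj] at this
      exact sub_right_injective this

/-- The permutations `σ` of the words of length `n` over `ZMod p` such that the increment
`σ x i - x i` of the `i`-th letter depends only on the letters of `x` before the `i`-th. This is
the `n`-fold iterated wreath product of cyclic groups of order `p`, acting on the rooted tree whose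
vertices at depth `k` are the words of length `k`. -/
def treeGroup (p n : ℕ) : Subgroup (Perm (Fin n → ZMod p)) where
  carrier := {σ | ∀ (i : Fin n) x y, AgreeTo i x y → σ x i - x i = σ y i - y i}
  one_mem' := fun i x y _ => by simp
  mul_mem' := by
    intro σ τ hσ hτ i x y h
    have h1 := hσ i (τ x) (τ y) ((agreeTo_apply_of_label hτ).2 h)
    have h2 := hτ i x y h
    rw [Perm.mul_apply, Perm.mul_apply, ← sub_add_sub_cancel _ (τ x i), h1, h2,
      sub_add_sub_cancel]
  inv_mem' := by
    intro σ hσ i x y h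
    have := hσ i (σ⁻¹ x) (σ⁻¹ y) ((agreeTo_apply_of_label hσ).1 (by simpa using h))
    simp only [← Perm.mul_apply, mul_inv_cancel, Perm.one_apply] at this
    rw [← neg_sub, this, neg_sub]

section label

variable {p n k : ℕ}

/-- The label of `σ` at depth `i` on the prefix of `x` of length `i`: what `σ` adds to the letter
`x i`. -/
def label (σ : treeGroup p n) (i : Fin n) (x : Fin n → ZMod p) : ZMod p := (σ • x) i - x i

theorem smul_apply_eq (σ : treeGroup p n) (x : Fin n → ZMod p) (i : Fin n) :
    (σ • x) i = x i + label σ i x := by simp [label]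

theorem label_congr (σ : treeGroup p n) {i : Fin n} {x y : Fin n → ZMod p} (h : AgreeTo i x y) :
    label σ i x = label σ i y := σ.2 i x y h

theorem agreeTo_smul_iff (σ : treeGroup p n) {x y : Fin n → ZMod p} :
    AgreeTo k (σ • x) (σ • y) ↔ AgreeTo k x y := agreeTo_apply_of_label σ.2

theorem label_mul (σ τ : treeGroup p n) (i : Fin n) (x : Fin n → ZMod p) :
    label (σ * τ) i x = label σ i (τ • x) + label τ i x := by
  simp [label, mul_smul]

@[simp] theorem label_one (i : Fin n) (x : Fin n → ZMod p) : label 1 i x = 0 := by simp [label]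

theorem treeGroup_ext {σ τ : treeGroup p n} (h : ∀ i x, label σ i x = label τ i x) : σ = τ := by
  apply Subtype.ext
  ext x i
  exact sub_left_injective (h i x)

theorem smul_agreeTo_iff (σ : treeGroup p n) {x : Fin n → ZMod p} :
    AgreeTo k (σ • x) x ↔ ∀ i : Fin n, (i : ℕ) < k → label σ i x = 0 := by
  simp [AgreeTo, label, sub_eq_zero]

/-- The element with prescribed labels `f`, where `f i x` may depend only on the first `i` letters
of `x`. -/
noncomputable def ofLabel [NeZero p] (f : Fin n → (Fin n → ZMod p) → ZMod p)
    (hf : ∀ (i : Fin n) x y, AgreeTo i x y → f i x = f i y) : treeGroup p n :=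
  ⟨Equiv.ofBijective (fun x i => x i + f i x) (Finite.injective_iff_bijective.1 (by
    intro x y h
    have key : ∀ k, AgreeTo k x y := by
      intro k
      induction k with
      | zero => exact fun j hj => absurd hj (Nat.not_lt_zero _)
      | succ k ih =>
        intro j hj
        rcases Nat.lt_succ_iff_lt_or_eq.1 hj with hj' | hj'
        · exact ih j hj'
        · have := congrFun h j
          simp only at this
          rw [hf j x y (hj' ▸ ih)] at this
          exact add_right_cancel this
    exact (key n).eq)), by
    intro i x y h
    simp [hf i x y h]⟩

theorem label_ofLabel [NeZero p] (f : Fin n → (Fin n → ZMod p) → ZMod p)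
    (hf : ∀ (i : Fin n) x y, AgreeTo i x y → f i x = f i y) (i : Fin n) (x : Fin n → ZMod p) :
    label (ofLabel f hf) i x = f i x := by
  simp [label, ofLabel, Subgroup.smul_def]

theorem ofLab_smul [NeZero p] (f : Fin n → (Fin n → ZMod p) → ZMod p)
    (hf : ∀ (i : Fin n) x y, AgreeTo i x y → f i x = f i y) (x : Fin n → ZMod p) :
    ofLabel f hf • x = fun i => x i + f i x := by
  funext i
  rw [smul_apply_eq, label_ofLabel]

/-- The stabilizer of depth `k`: the elements that fix the first `k` letters of all words. -/
def level (p n k : ℕ) : Subgroup (treeGroup p n) where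
  carrier := {σ | ∀ x : Fin n → ZMod p, AgreeTo k (σ • x) x}
  one_mem' := fun x => by simpa using AgreeTo.refl k x
  mul_mem' := fun {σ τ} hσ hτ x => by
    rw [mul_smul]
    exact (hσ _).trans (hτ _)
  inv_mem' := fun {σ} hσ x => by simpa using (hσ (σ⁻¹ • x)).symm

theorem mem_level {σ : treeGroup p n} :
    σ ∈ level p n k ↔ ∀ x : Fin n → ZMod p, AgreeTo k (σ • x) x := Iff.rfl

theorem mem_level_iff_label {σ : treeGroup p n} :
    σ ∈ level p n k ↔ ∀ i : Fin n, (i : ℕ) < k → ∀ x, label σ i x = 0 := by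
  simp only [mem_level, smul_agreeTo_iff]
  exact ⟨fun h i hi x => h x i hi, fun h x i hi => h i hi x⟩

instance level_normal (p n k : ℕ) : (level p n k).Normal :=
  ⟨fun σ hσ τ x => by
    have := (agreeTo_smul_iff τ).2 (hσ (τ⁻¹ • x))
    simpa [mul_smul] using this⟩

theorem level_zero : level p n 0 = ⊤ :=
  eq_top_iff.2 fun _ _ => mem_level_iff_label.2 fun _ hi => absurd hi (Nat.not_lt_zero _)

theorem level_self : level p n n = ⊥ :=
  eq_bot_iff.2 fun σ hσ => Subgroup.mem_bot.2 <| treeGroup_ext fun i x => by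
    rw [mem_level_iff_label.1 hσ i i.2 x, label_one]

theorem level_anti {l : ℕ} (h : k ≤ l) : level p n l ≤ level p n k :=
  fun _ hσ x => (hσ x).mono h

theorem mem_level_succ_iff {σ : treeGroup p n} (hk : k < n) (hσ : σ ∈ level p n k) :
    σ ∈ level p n (k + 1) ↔ ∀ x, label σ ⟨k, hk⟩ x = 0 := by
  refine ⟨fun h x => mem_level_iff_label.1 h ⟨k, hk⟩ k.lt_succ_self x, fun h => ?_⟩
  refine mem_level_iff_label.2 fun i hi x => ?_
  rcases Nat.lt_succ_iff_lt_or_eq.1 hi with hi' | hi'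
  · exact mem_level_iff_label.1 hσ i hi' x
  · obtain rfl : i = ⟨k, hk⟩ := Fin.ext hi'
    exact h x

/-- At depth `i`, labels are additive on the stabilizer of depth `i`; in general they only satisfy
the cocycle identity `label_mul`. -/
theorem label_mul_of_mem_level {σ τ : treeGroup p n} {i : Fin n} (hτ : τ ∈ level p n i)
    (x : Fin n → ZMod p) : label (σ * τ) i x = label σ i x + label τ i x := by
  rw [label_mul, label_congr σ (hτ x)]

theorem label_pow_of_mem_level {σ : treeGroup p n} {i : Fin n} (hσ : σ ∈ level p n i)
    (x : Fin n → ZMod p) (m : ℕ) : label (σ ^ m) i x = m * label σ i x := by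
  induction m with
  | zero => simp
  | succ m ih => rw [pow_succ, label_mul_of_mem_level hσ, ih]; push_cast; ring

theorem label_inv_of_mem_level {σ : treeGroup p n} {i : Fin n} (hσ : σ ∈ level p n i)
    (x : Fin n → ZMod p) : label σ⁻¹ i x = - label σ i x := by
  have := label_mul_of_mem_level (σ := σ⁻¹) hσ x
  rw [inv_mul_cancel, label_one] at this
  exact eq_neg_of_add_eq_zero_left this.symm

theorem label_conj {σ : treeGroup p n} {i : Fin n} (hσ : σ ∈ level p n i) (τ : treeGroup p n)
    (x : Fin n → ZMod p) : label (τ * σ * τ⁻¹) i (τ • x) = label σ i x := by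
  have h1 := label_mul (τ * σ * τ⁻¹) τ i x
  rw [inv_mul_cancel_right, label_mul_of_mem_level hσ, add_comm] at h1
  exact (add_right_cancel h1).symm

variable [NeZero p]

/-- The translation by the word `d`. -/
noncomputable def transl (d : Fin n → ZMod p) : treeGroup p n :=
  ofLabel (fun i _ => d i) fun _ _ _ _ => rfl

@[simp] theorem label_transl (d : Fin n → ZMod p) (i x) : label (transl d) i x = d i :=
  label_ofLabel _ _ _ _

theorem transl_smul (d x : Fin n → ZMod p) : transl d • x = x + d := ofLab_smul _ _ _

theorem transl_inv_smul (d x : Fin n → ZMod p) : (transl d)⁻¹ • x = x - d := by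
  rw [inv_smul_eq_iff, transl_smul, sub_add_cancel]

instance : MulAction.IsPretransitive (treeGroup p n) (Fin n → ZMod p) :=
  ⟨fun x y => ⟨transl (y - x), by rw [transl_smul, add_sub_cancel]⟩⟩

/-- The element that only changes the letter at depth `i`, adding to it the value of `f` at the
prefix of length `i`. -/
noncomputable def rot (i : Fin n) (f : (Fin n → ZMod p) → ZMod p) : treeGroup p n :=
  ofLabel (fun j x => if j = i then f (trunc i x) else 0) (by
    intro j x y h
    by_cases hj : j = i
    · subst hj
      simp [trunc_eq_iff.2 h]
    · simp [hj])

theorem label_rot (i j : Fin n) (f : (Fin n → ZMod p) → ZMod p) (x) :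
    label (rot i f) j x = if j = i then f (trunc i x) else 0 := label_ofLabel _ _ _ _

theorem label_rot_self (i : Fin n) (f : (Fin n → ZMod p) → ZMod p) (x) :
    label (rot i f) i x = f (trunc i x) := by rw [label_rot, if_pos rfl]

theorem label_rot_of_ne {i j : Fin n} (h : j ≠ i) (f : (Fin n → ZMod p) → ZMod p) (x) :
    label (rot i f) j x = 0 := by rw [label_rot, if_neg h]

theorem rot_mem_level (i : Fin n) (f : (Fin n → ZMod p) → ZMod p) : rot i f ∈ level p n i :=
  mem_level_iff_label.2 fun j hj x => label_rot_of_ne (fun h => by simp [h] at hj) f x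

theorem rot_add (i : Fin n) (f g : (Fin n → ZMod p) → ZMod p) :
    rot i (f + g) = rot i f * rot i g := by
  refine treeGroup_ext fun j x => ?_
  by_cases hj : j = i
  · subst hj
    rw [label_mul_of_mem_level (rot_mem_level j g)]
    simp [label_rot_self]
  · rw [label_mul]
    simp [label_rot_of_ne hj]

theorem rot_zero (i : Fin n) : rot i (0 : (Fin n → ZMod p) → ZMod p) = 1 :=
  treeGroup_ext fun j x => by simp [label_rot]

theorem rot_neg (i : Fin n) (f : (Fin n → ZMod p) → ZMod p) : rot i (-f) = (rot i f)⁻¹ := by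
  rw [eq_inv_iff_mul_eq_one, ← rot_add, neg_add_cancel, rot_zero]

end label

/-! ### Sums of labels over blocks -/

section blockSum

variable {p n k : ℕ} [NeZero p]

open Classical in
/-- The words of length `i` (encoded as words that vanish from position `i` on) whose first `k`
letters are those of `v`, i.e. the vertices at depth `i` below the vertex `v` at depth `k`. -/
noncomputable def block {p n : ℕ} [NeZero p] (k i : ℕ) (v : Fin n → ZMod p) :
    Finset (Fin n → ZMod p) :=
  Finset.univ.filter fun x => AgreeTo k x v ∧ ∀ j : Fin n, i ≤ j → x j = 0

theorem mem_block {k i : ℕ} {v x : Fin n → ZMod p} :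
    x ∈ block k i v ↔ AgreeTo k x v ∧ ∀ j : Fin n, i ≤ j → x j = 0 := by
  simp [block]

theorem block_congr {k : ℕ} (i : ℕ) {v w : Fin n → ZMod p} (h : AgreeTo k v w) :
    block k i v = block k i w := by
  ext x
  rw [mem_block, mem_block]
  exact and_congr_left fun _ => ⟨fun h' => h'.trans h, fun h' => h'.trans h.symm⟩

/-- The sum of the labels of `σ` over the vertices at depth `i` below the vertex `v` at depth `k`.
On `level p n k` these sums are homomorphisms; for `v` fixed and `k ≤ i < n` they describe the
abelianization of the factor of `level p n k` that acts below `v`. -/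
noncomputable def blockSum (k : ℕ) (i : Fin n) (v : Fin n → ZMod p) (σ : treeGroup p n) : ZMod p :=
  ∑ x ∈ block k i v, label σ i x

theorem blockSum_congr {i : Fin n} {v w : Fin n → ZMod p} (h : AgreeTo k v w)
    (σ : treeGroup p n) : blockSum k i v σ = blockSum k i w σ := by
  rw [blockSum, block_congr _ h, blockSum]

theorem sum_block_smul {i : ℕ} (hk : k ≤ i) (v : Fin n → ZMod p) (τ : treeGroup p n)
    {g : (Fin n → ZMod p) → ZMod p} (hg : ∀ x y, AgreeTo i x y → g x = g y) :
    ∑ x ∈ block k i v, g (τ • x) = ∑ x ∈ block k i (τ • v), g x := by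
  refine Finset.sum_nbij' (fun x => trunc i (τ • x)) (fun x => trunc i (τ⁻¹ • x)) ?_ ?_ ?_ ?_ ?_
  · intro x hx
    rw [mem_block] at hx ⊢
    exact ⟨((agreeTo_trunc _ _).mono hk).trans ((agreeTo_smul_iff τ).2 hx.1),
      fun j hj => trunc_apply_of_le hj _⟩
  · intro x hx
    rw [mem_block] at hx ⊢
    refine ⟨((agreeTo_trunc _ _).mono hk).trans ((agreeTo_smul_iff τ).1 ?_),
      fun j hj => trunc_apply_of_le hj _⟩
    rw [smul_inv_smul]
    exact hx.1
  · intro x hx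
    rw [mem_block] at hx
    conv_rhs => rw [← trunc_eq_self hx.2]
    rw [trunc_eq_iff, ← agreeTo_smul_iff τ, smul_inv_smul]
    exact agreeTo_trunc _ _
  · intro x hx
    rw [mem_block] at hx
    conv_rhs => rw [← trunc_eq_self hx.2]
    rw [trunc_eq_iff, ← agreeTo_smul_iff τ⁻¹, inv_smul_smul]
    exact agreeTo_trunc _ _
  · intro x _
    exact hg _ _ (agreeTo_trunc _ _).symm

/-- The cocycle identity for block sums. -/
theorem blockSum_mul {i : Fin n} (hk : k ≤ i) (v : Fin n → ZMod p) (σ τ : treeGroup p n) :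
    blockSum k i v (σ * τ) = blockSum k i (τ • v) σ + blockSum k i v τ := by
  simp only [blockSum, label_mul, Finset.sum_add_distrib]
  rw [sum_block_smul hk v τ (fun _ _ => label_congr σ)]

theorem blockSum_one (i : Fin n) (v : Fin n → ZMod p) : blockSum k i v 1 = 0 := by
  simp [blockSum]

theorem blockSum_mul_of_mem {i : Fin n} (hk : k ≤ i) (v : Fin n → ZMod p) (σ : treeGroup p n)
    {τ : treeGroup p n} (hτ : τ ∈ level p n k) :
    blockSum k i v (σ * τ) = blockSum k i v σ + blockSum k i v τ := by
  rw [blockSum_mul hk, blockSum_congr (hτ v)]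

theorem blockSum_inv_of_mem {i : Fin n} (hk : k ≤ i) (v : Fin n → ZMod p)
    {τ : treeGroup p n} (hτ : τ ∈ level p n k) :
    blockSum k i v τ⁻¹ = - blockSum k i v τ := by
  have := blockSum_mul_of_mem hk v τ⁻¹ hτ
  rw [inv_mul_cancel, blockSum_one] at this
  exact eq_neg_of_add_eq_zero_left this.symm

theorem blockSum_pow_of_mem {i : Fin n} (hk : k ≤ i) (v : Fin n → ZMod p)
    {τ : treeGroup p n} (hτ : τ ∈ level p n k) (m : ℕ) :
    blockSum k i v (τ ^ m) = m * blockSum k i v τ := by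
  induction m with
  | zero => simp [blockSum_one]
  | succ m ih => rw [pow_succ, blockSum_mul_of_mem hk v _ hτ, ih]; push_cast; ring

theorem blockSum_conj {i : Fin n} (hk : k ≤ i) (v : Fin n → ZMod p) {σ : treeGroup p n}
    (hσ : σ ∈ level p n k) (τ : treeGroup p n) :
    blockSum k i (τ • v) (τ * σ * τ⁻¹) = blockSum k i v σ := by
  have h1 := blockSum_mul hk v (τ * σ * τ⁻¹) τ
  rw [inv_mul_cancel_right, blockSum_mul_of_mem hk v _ hσ, add_comm] at h1
  exact (add_right_cancel h1).symm

theorem blockSum_eq_zero_of_mem {i : Fin n} (v : Fin n → ZMod p) {l : ℕ} (hl : i < l)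
    {σ : treeGroup p n} (hσ : σ ∈ level p n l) : blockSum k i v σ = 0 :=
  Finset.sum_eq_zero fun x _ => mem_level_iff_label.1 hσ i hl x

theorem blockSum_self {i : Fin n} {v : Fin n → ZMod p} (σ : treeGroup p n) :
    blockSum i i v σ = label σ i v := by
  have : block i i v = {trunc i v} := by
    ext x
    rw [mem_block, Finset.mem_singleton]
    constructor
    · rintro ⟨h, h'⟩
      rw [← trunc_eq_self h', trunc_eq_iff]
      exact h
    · rintro rfl
      exact ⟨agreeTo_trunc _ _, fun j hj => trunc_apply_of_le hj _⟩
  rw [blockSum, this, Finset.sum_singleton]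
  exact label_congr σ (agreeTo_trunc _ _)

/-- Every family of block sums is attained: put the prescribed value on the vertex `v00…0`. -/
theorem exists_blockSum_eq (k : ℕ) (m : (Fin n → ZMod p) → Fin n → ZMod p) :
    ∃ σ ∈ level p n k, ∀ i : Fin n, k ≤ i → ∀ v, blockSum k i v σ = m (trunc k v) i := by
  classical
  refine ⟨ofLabel (fun i x => if k ≤ i ∧ ∀ j : Fin n, k ≤ j → j < i → x j = 0 then m (trunc k x) i
    else 0) ?_, ?_, ?_⟩
  · intro i x y h
    by_cases hi : k ≤ i
    · rw [trunc_eq_iff.2 (h.mono hi)]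
      have : (∀ j : Fin n, k ≤ j → j < i → x j = 0) ↔
          (∀ j : Fin n, k ≤ j → j < i → y j = 0) :=
        forall_congr' fun j => imp_congr_right fun _ =>
          ⟨fun h1 h2 => (h j h2) ▸ h1 h2, fun h1 h2 => (h j h2) ▸ h1 h2⟩
      simp only [this]
    · simp [hi]
  · refine mem_level_iff_label.2 fun i hi x => ?_
    rw [label_ofLabel, if_neg fun h => absurd h.1 (not_le.2 hi)]
  · intro i hi v
    rw [blockSum, Finset.sum_eq_single (trunc k v)]
    · rw [label_ofLabel, if_pos ⟨hi, fun j hj _ => trunc_apply_of_le hj _⟩, trunc_trunc]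
    · intro x hx hne
      rw [mem_block] at hx
      rw [label_ofLabel, if_neg]
      rintro ⟨_, h⟩
      refine hne ?_
      rw [← trunc_eq_iff.2 hx.1, trunc_eq_self]
      intro j hj
      by_cases hji : j < i
      · exact h j hj hji
      · exact hx.2 j (not_lt.1 hji)
    · intro h
      refine absurd (mem_block.2 ⟨agreeTo_trunc _ _, fun j hj => ?_⟩) h
      exact trunc_apply_of_le (hi.trans hj) _

end blockSum

/-! ### Homomorphisms killing an element of first nontrivial depth `k` -/

section commute

variable {p n k : ℕ}

/-- The elements that move only words below the vertex `v` at depth `k`, and fix that vertex: the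
factor at `v` of `level p n k`, seen as a direct power of a smaller iterated wreath product. -/
def rist (p n k : ℕ) (v : Fin n → ZMod p) : Subgroup (treeGroup p n) where
  carrier := {σ | σ ∈ level p n k ∧ ∀ x : Fin n → ZMod p, ¬ AgreeTo k x v → σ • x = x}
  one_mem' := ⟨one_mem _, fun x _ => one_smul _ x⟩
  mul_mem' := fun {σ τ} hσ hτ => ⟨mul_mem hσ.1 hτ.1, fun x hx => by
    rw [mul_smul, hτ.2 x hx, hσ.2 x hx]⟩
  inv_mem' := fun {σ} hσ => ⟨inv_mem hσ.1, fun x hx => by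
    rw [inv_smul_eq_iff, hσ.2 x hx]⟩

theorem treeGroup_ext_smul {σ τ : treeGroup p n} (h : ∀ x : Fin n → ZMod p, σ • x = τ • x) :
    σ = τ := treeGroup_ext fun i x => by rw [label, h, label]

theorem commute_of_mem_rist {v : Fin n → ZMod p}
    {a b : treeGroup p n} (ha : a ∈ rist p n k v) (hb : b ∈ level p n k)
    (hb' : ∀ x : Fin n → ZMod p, AgreeTo k x v → b • x = x) : Commute a b := by
  refine treeGroup_ext_smul fun x => ?_
  rw [mul_smul, mul_smul]
  by_cases hx : AgreeTo k x v
  · rw [hb' x hx, hb' _ ((ha.1 x).trans hx)]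
  · rw [ha.2 x hx, ha.2 _ fun h => hx ((hb x).symm.trans h)]

theorem conj_mem_rist {v : Fin n → ZMod p} {a : treeGroup p n} (ha : a ∈ rist p n k v)
    (τ : treeGroup p n) : τ * a * τ⁻¹ ∈ rist p n k (τ • v) := by
  refine ⟨(level_normal p n k).conj_mem a ha.1 τ, fun x hx => ?_⟩
  rw [mul_smul, mul_smul, ha.2, smul_inv_smul]
  rwa [← agreeTo_smul_iff τ, smul_inv_smul]

variable [NeZero p]

open Classical in
/-- The element that acts as `σ` below the vertices in `S` at depth `k` and trivially elsewhere.
It is meaningful for `σ ∈ level p n k`; the labels of `σ` at depths before `k` are dropped. -/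
noncomputable def restrictTo (k : ℕ) (S : Set (Fin n → ZMod p)) (σ : treeGroup p n) :
    treeGroup p n :=
  ofLabel (fun i x => if k ≤ i ∧ trunc k x ∈ S then label σ i x else 0) (by
    intro i x y h
    by_cases hi : k ≤ i
    · simp [trunc_eq_iff.2 (h.mono hi), label_congr σ h]
    · simp [hi])

open Classical in
theorem label_restrictTo (S : Set (Fin n → ZMod p)) (σ : treeGroup p n) (i x) :
    label (restrictTo k S σ) i x = if k ≤ i ∧ trunc k x ∈ S then label σ i x else 0 :=
  label_ofLabel _ _ _ _

theorem restrictTo_mem_level (S : Set (Fin n → ZMod p)) (σ : treeGroup p n) :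
    restrictTo k S σ ∈ level p n k :=
  mem_level_iff_label.2 fun i hi x => by
    rw [label_restrictTo, if_neg fun h => absurd h.1 (not_le.2 hi)]

theorem restrictTo_smul_of_notMem {S : Set (Fin n → ZMod p)} (σ : treeGroup p n)
    {x : Fin n → ZMod p} (hx : trunc k x ∉ S) : restrictTo k S σ • x = x := by
  funext i
  rw [smul_apply_eq, label_restrictTo, if_neg fun h => hx h.2, add_zero]

theorem restrictTo_smul_of_mem {S : Set (Fin n → ZMod p)} {σ : treeGroup p n}
    (hσ : σ ∈ level p n k) {x : Fin n → ZMod p} (hx : trunc k x ∈ S) :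
    restrictTo k S σ • x = σ • x := by
  funext i
  rw [smul_apply_eq, smul_apply_eq, label_restrictTo]
  by_cases hi : k ≤ i
  · rw [if_pos ⟨hi, hx⟩]
  · rw [if_neg fun h => hi h.1, mem_level_iff_label.1 hσ i (not_le.1 hi)]

theorem restrictTo_singleton_mem (v : Fin n → ZMod p) (σ : treeGroup p n) :
    restrictTo k {trunc k v} σ ∈ rist p n k v :=
  ⟨restrictTo_mem_level _ _, fun _ hx => restrictTo_smul_of_notMem σ fun h =>
    hx (trunc_eq_iff.1 h)⟩

theorem restrictTo_union {S T : Set (Fin n → ZMod p)} (h : Disjoint S T) {σ : treeGroup p n}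
    (hσ : σ ∈ level p n k) :
    restrictTo k (S ∪ T) σ = restrictTo k S σ * restrictTo k T σ := by
  refine treeGroup_ext_smul fun x => ?_
  rw [mul_smul]
  by_cases hT : trunc k x ∈ T
  · rw [restrictTo_smul_of_mem hσ hT, restrictTo_smul_of_mem hσ (Or.inr hT),
      restrictTo_smul_of_notMem]
    rw [trunc_eq_iff.2 (hσ x)]
    exact h.notMem_of_mem_right hT
  · rw [restrictTo_smul_of_notMem σ hT]
    by_cases hS : trunc k x ∈ S
    · rw [restrictTo_smul_of_mem hσ hS, restrictTo_smul_of_mem hσ (Or.inl hS)]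
    · rw [restrictTo_smul_of_notMem σ hS, restrictTo_smul_of_notMem]
      exact fun h => h.elim hS hT

theorem restrictTo_univ {σ : treeGroup p n} (hσ : σ ∈ level p n k) :
    restrictTo k Set.univ σ = σ :=
  treeGroup_ext_smul fun _ => restrictTo_smul_of_mem hσ (Set.mem_univ _)

theorem level_le_closure (k : ℕ) :
    level p n k ≤ Subgroup.closure (⋃ v, (rist p n k v : Set (treeGroup p n))) := by
  classical
  intro σ hσ
  rw [← restrictTo_univ hσ, ← Finset.coe_univ]
  generalize (Finset.univ : Finset (Fin n → ZMod p)) = S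
  induction S using Finset.induction_on with
  | empty =>
    have : restrictTo k ((∅ : Finset (Fin n → ZMod p)) : Set (Fin n → ZMod p)) σ = 1 :=
      treeGroup_ext_smul fun x => by
        rw [restrictTo_smul_of_notMem σ (by simp), one_smul]
    rw [this]
    exact one_mem _
  | insert v S hv ih =>
    rw [Finset.coe_insert, Set.insert_eq,
      restrictTo_union (Set.disjoint_singleton_left.2 (by simpa using hv)) hσ]
    refine mul_mem (Subgroup.subset_closure (Set.mem_iUnion.2 ⟨v, ?_, fun x hx => ?_⟩)) ih
    · exact restrictTo_mem_level _ _
    · refine restrictTo_smul_of_notMem σ fun h => hx ?_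
      rw [Set.mem_singleton_iff] at h
      exact h ▸ (agreeTo_trunc k x).symm

variable {Q : Type*} [Group Q] (π : treeGroup p n →* Q)

theorem commute_of_commute_rist
    (h : ∀ v w, ∀ a ∈ rist p n k v, ∀ b ∈ rist p n k w, Commute (π a) (π b))
    {a b : treeGroup p n} (ha : a ∈ level p n k) (hb : b ∈ level p n k) :
    Commute (π a) (π b) := by
  have aux : ∀ (S : Set (treeGroup p n)) (c : treeGroup p n), (∀ s ∈ S, Commute (π s) (π c)) →
      ∀ s ∈ Subgroup.closure S, Commute (π s) (π c) := by
    intro S c hS s hs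
    induction hs using Subgroup.closure_induction with
    | mem x hx => exact hS x hx
    | one => rw [map_one]; exact Commute.one_left _
    | mul x y _ _ hx hy => rw [map_mul]; exact hx.mul_left hy
    | inv x _ hx => rw [map_inv]; exact hx.inv_left
  refine aux _ b (fun s hs => ?_) a (level_le_closure k ha)
  refine (aux _ s (fun t ht => ?_) b (level_le_closure k hb)).symm
  obtain ⟨v, hv⟩ := Set.mem_iUnion.1 hs
  obtain ⟨w, hw⟩ := Set.mem_iUnion.1 ht
  exact h w v t hw s hv

end commute

/-- If a homomorphism `π` kills an element `y` of `level p n k` that does not lie in `level p n (k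
+ 1)`, then it is abelian on `level p n k`. Below a vertex `w` at depth `k + 1` moved by a
conjugate of `y`, an element has the same image as its conjugate below another vertex, with which
everything below `w` commutes; and modulo `level p n (k + 1)` the group `rist p n k v` is generated
by the restriction of `y`, whose image is central in that of `rist p n k v`. -/
theorem commute_map_of_mem_level {p n k : ℕ} [Fact p.Prime] {Q : Type*} [Group Q]
    (π : treeGroup p n →* Q) (hk : k < n) {y : treeGroup p n} (hy : y ∈ level p n k)
    {v₀ : Fin n → ZMod p} (hv : label y ⟨k, hk⟩ v₀ ≠ 0) (hπ : π y = 1)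
    {a b : treeGroup p n} (ha : a ∈ level p n k) (hb : b ∈ level p n k) :
    Commute (π a) (π b) := by
  have h1 : ∀ v, ∃ y ∈ level p n k, π y = 1 ∧ label y ⟨k, hk⟩ v ≠ 0 := by
    intro v
    obtain ⟨τ, rfl⟩ := MulAction.exists_smul_eq (treeGroup p n) v₀ v
    refine ⟨τ * y * τ⁻¹, (level_normal p n k).conj_mem y hy τ, by simp [hπ], ?_⟩
    rwa [label_conj (i := ⟨k, hk⟩) hy]
  have h2 : ∀ v w, ¬ AgreeTo (k + 1) v w → ∀ a ∈ rist p n (k + 1) v, ∀ b ∈ rist p n (k + 1) w,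
      Commute (π a) (π b) := fun v w hvw a ha b hb =>
    (commute_of_mem_rist ha hb.1 fun x hx => hb.2 x fun h => hvw (hx.symm.trans h)).map π
  have h3 : ∀ {a b}, a ∈ level p n (k + 1) → b ∈ level p n (k + 1) → Commute (π a) (π b) := by
    intro a b ha hb
    refine commute_of_commute_rist π (fun v w a ha b hb => ?_) ha hb
    by_cases hvw : AgreeTo (k + 1) v w
    · obtain ⟨y, hy, hπy, hyv⟩ := h1 v
      have : π a = π (y * a * y⁻¹) := by simp [hπy]
      rw [this]
      refine h2 (y • v) w (fun h => hyv ?_) _ (conj_mem_rist ha y) _ hb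
      exact (smul_agreeTo_iff y).1 (h.trans hvw.symm) ⟨k, hk⟩ k.lt_succ_self
    · exact h2 v w hvw a ha b hb
  refine commute_of_commute_rist π (fun v w a ha b hb => ?_) ha hb
  by_cases hvw : AgreeTo k v w
  · obtain ⟨y, hy, hπy, hyv⟩ := h1 v
    set z := restrictTo k {trunc k v} y with hz
    have hzv : label z ⟨k, hk⟩ v = label y ⟨k, hk⟩ v := by
      rw [hz, label_restrictTo, if_pos ⟨le_rfl, rfl⟩]
    have hzl : z ∈ level p n k := restrictTo_mem_level _ _
    have hzr : z ∈ rist p n k v := restrictTo_singleton_mem _ _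
    have h4 : ∀ r ∈ rist p n k v, Commute (π z) (π r) := by
      intro r hr
      have hy' : y = z * restrictTo k {trunc k v}ᶜ y := by
        rw [hz, ← restrictTo_union disjoint_compl_right hy, Set.union_compl_self,
          restrictTo_univ hy]
      rw [eq_mul_inv_of_mul_eq hy'.symm, map_mul, hπy, one_mul]
      refine Commute.map (Commute.inv_left (Commute.symm ?_)) π
      refine commute_of_mem_rist hr (restrictTo_mem_level _ _) fun x hx => ?_
      exact restrictTo_smul_of_notMem y fun h => h (trunc_eq_iff.2 hx)
    have h5 : ∀ r ∈ rist p n k v, ∃ m : ℕ, ∃ s ∈ level p n (k + 1), s ∈ rist p n k v ∧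
        r = z ^ m * s := by
      intro r hr
      let m : ℕ := (label r ⟨k, hk⟩ v / label z ⟨k, hk⟩ v).val
      have hm : (m : ZMod p) * label z ⟨k, hk⟩ v = label r ⟨k, hk⟩ v := by
        rw [ZMod.natCast_zmod_val, div_mul_cancel₀ _ (hzv ▸ hyv)]
      have hs : (z ^ m)⁻¹ * r ∈ rist p n k v := mul_mem (inv_mem (pow_mem hzr m)) hr
      refine ⟨m, (z ^ m)⁻¹ * r, (mem_level_succ_iff hk hs.1).2 fun x => ?_, hs, by group⟩
      by_cases hx : AgreeTo k x v
      · have : AgreeTo ((⟨k, hk⟩ : Fin n) : ℕ) x v := hx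
        rw [label_congr _ this, label_mul_of_mem_level (i := ⟨k, hk⟩) hr.1,
          label_inv_of_mem_level (i := ⟨k, hk⟩) (pow_mem hzl m),
          label_pow_of_mem_level (i := ⟨k, hk⟩) hzl, hm, neg_add_cancel]
      · rw [label, hs.2 x hx, sub_self]
    have hb' : b ∈ rist p n k v := ⟨hb.1, fun x hx => hb.2 x fun h => hx (h.trans hvw.symm)⟩
    obtain ⟨m, s, hs, hs', rfl⟩ := h5 a ha
    obtain ⟨l, t, ht, ht', rfl⟩ := h5 b hb'
    simp only [map_mul, map_pow]
    refine Commute.mul_left ?_ ?_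
    · refine Commute.pow_left (Commute.mul_right (Commute.pow_right (Commute.refl _) _) ?_) _
      exact h4 t ht'
    · exact Commute.mul_right ((h4 s hs').symm.pow_right l) (h3 hs ht)
  · exact (commute_of_mem_rist ha hb.1 fun x hx =>
      hb.2 x fun h => hvw (hx.symm.trans h)).map π

/-! ### Elements with vanishing block sums -/

section kernel

variable {p n k : ℕ} [NeZero p]

theorem conj_transl_rot_single [DecidableEq (Fin n → ZMod p)] {i : Fin n} {l l' : Fin n → ZMod p}
    (hl : ∀ j : Fin n, i ≤ j → l j = 0) (hl' : ∀ j : Fin n, i ≤ j → l' j = 0) (c : ZMod p) :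
    transl (l' - l) * rot i (Pi.single l c) * (transl (l' - l))⁻¹ = rot i (Pi.single l' c) := by
  refine treeGroup_ext_smul fun x => ?_
  rw [mul_smul, mul_smul, transl_smul, transl_inv_smul]
  funext j
  rw [Pi.add_apply, smul_apply_eq, smul_apply_eq, label_rot, label_rot]
  have h : trunc i (x - (l' - l)) = l ↔ trunc i x = l' := by
    rw [← trunc_eq_self hl, trunc_eq_iff]
    conv_rhs => rw [← trunc_eq_self hl', trunc_eq_iff]
    refine forall_congr' fun j => imp_congr_right fun hj => ?_
    have : trunc i l j = l j := by rw [trunc_eq_self hl]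
    rw [Pi.sub_apply, Pi.sub_apply, this, sub_eq_iff_eq_add, add_sub_cancel]
  simp only [Pi.single_apply, h, Pi.sub_apply]
  ring

variable {Q : Type*} [Group Q] {π : treeGroup p n →* Q}

/-- Conjugation by translations identifies the images of the rotations at two vertices of equal
depth below the same vertex of depth `k`. -/
theorem map_rot_eq_one
    (hc : ∀ a ∈ level p n k, ∀ b ∈ level p n k, Commute (π a) (π b)) {i : Fin n} (hk : k ≤ i)
    {f : (Fin n → ZMod p) → ZMod p} (hf : ∀ v, ∑ x ∈ block k i v, f x = 0) :
    π (rot i f) = 1 := by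
  classical
  let U : AddSubgroup ((Fin n → ZMod p) → ZMod p) :=
    { carrier := {f | π (rot i f) = 1}
      zero_mem' := by simp [rot_zero]
      add_mem' := fun {f g} (hf : _ = _) (hg : _ = _) => by
        simp only [Set.mem_ofPred_eq, rot_add, map_mul, hf, hg, one_mul]
      neg_mem' := fun {f} (hf : _ = _) => by
        simp only [Set.mem_ofPred_eq, rot_neg, map_inv, hf, inv_one] }
  have hU : ∀ {f}, f ∈ U ↔ π (rot i f) = 1 := Iff.rfl
  have h1 : ∀ l, (∀ j : Fin n, i ≤ j → l j = 0) → ∀ c,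
      (Pi.single l c - Pi.single (trunc k l) c : (Fin n → ZMod p) → ZMod p) ∈ U := by
    intro l hl c
    have hl' : ∀ j : Fin n, i ≤ j → trunc k l j = 0 := fun j hj =>
      trunc_apply_of_le (hk.trans hj) l
    rw [hU, sub_eq_add_neg, rot_add, rot_neg, map_mul, map_inv, mul_inv_eq_one,
      ← conj_transl_rot_single hl hl', map_mul, map_mul, map_inv]
    refine ((hc _ ?_ _ (level_anti hk (rot_mem_level i _))).mul_inv_cancel).symm
    refine mem_level_iff_label.2 fun j hj x => ?_
    rw [label_transl, Pi.sub_apply, agreeTo_trunc k l j hj, sub_self]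
  set W : Finset (Fin n → ZMod p) := Finset.univ.filter fun x => ∀ j : Fin n, i ≤ j → x j = 0
    with hW
  have hWf : rot i f = rot i (∑ l ∈ W, Pi.single l (f l)) := by
    refine treeGroup_ext fun j x => ?_
    rw [label_rot, label_rot]
    congr 1
    rw [Finset.sum_apply, Finset.sum_eq_single (trunc i x)]
    · simp
    · intro l _ hl
      simp [hl.symm]
    · intro h
      refine absurd ?_ h
      rw [hW, Finset.mem_filter]
      exact ⟨Finset.mem_univ _, fun j hj => trunc_apply_of_le hj x⟩
  have hzero : ∑ l ∈ W, Pi.single (trunc k l) (f l) = (0 : (Fin n → ZMod p) → ZMod p) := by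
    funext v
    rw [Finset.sum_apply, Pi.zero_apply]
    simp only [Pi.single_apply]
    rw [← Finset.sum_filter]
    by_cases hv : trunc k v = v
    · rw [← hf v]
      refine Finset.sum_congr ?_ fun _ _ => rfl
      ext x
      rw [Finset.mem_filter, mem_block, hW, Finset.mem_filter, ← trunc_eq_iff, hv]
      simp only [Finset.mem_univ, true_and]
      tauto
    · refine Finset.sum_eq_zero fun l hl => absurd ?_ hv
      rw [(Finset.mem_filter.1 hl).2, trunc_trunc]
  rw [hWf, ← hU, ← sub_zero (∑ l ∈ W, Pi.single l (f l)), ← hzero, ← Finset.sum_sub_distrib]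
  exact sum_mem fun l hl => h1 l (Finset.mem_filter.1 hl).2 _

/-- A homomorphism that is abelian on `level p n k` factors there through the block sums. -/
theorem map_eq_one_of_blockSum
    (hc : ∀ a ∈ level p n k, ∀ b ∈ level p n k, Commute (π a) (π b))
    {σ : treeGroup p n} (hσ : σ ∈ level p n k)
    (h : ∀ i : Fin n, k ≤ i → ∀ v, blockSum k i v σ = 0) : π σ = 1 := by
  have key : ∀ m ≤ n, k ≤ m → ∀ σ ∈ level p n m,
      (∀ i : Fin n, k ≤ i → ∀ v, blockSum k i v σ = 0) → π σ = 1 := by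
    intro m hm
    induction hm using Nat.decreasingInduction with
    | self =>
      intro _ σ hσ _
      rw [level_self, Subgroup.mem_bot] at hσ
      rw [hσ, map_one]
    | of_succ m hm ih =>
      intro hk σ hσ h
      let i : Fin n := ⟨m, hm⟩
      have hr : rot i (label σ i) ∈ level p n m := rot_mem_level i _
      have hrk := level_anti hk hr
      have hb : ∀ v, ∀ j : Fin n, k ≤ j → blockSum k j v (rot i (label σ i)) = 0 := by
        intro v j hj
        by_cases hji : j = i
        · subst hji
          rw [← h _ hj v]
          refine Finset.sum_congr rfl fun x hx => ?_
          rw [label_rot_self]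
          exact label_congr σ (agreeTo_trunc _ _)
        · exact Finset.sum_eq_zero fun x _ => label_rot_of_ne hji _ _
      have h1 : π (rot i (label σ i)) = 1 := by
        refine map_rot_eq_one hc hk fun v => ?_
        exact h i hk v
      have h2 := ih (hk.trans m.le_succ) ((rot i (label σ i))⁻¹ * σ) ?_ ?_
      · rwa [map_mul, map_inv, h1, inv_one, one_mul] at h2
      · refine (mem_level_succ_iff hm (mul_mem (inv_mem hr) hσ)).2 fun x => ?_
        rw [label_mul_of_mem_level (i := i) hσ, label_inv_of_mem_level (i := i) hr, label_rot_self,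
          label_congr σ (agreeTo_trunc i x), neg_add_cancel]
      · intro j hj v
        rw [blockSum_mul_of_mem hj v _ (level_anti hk hσ), blockSum_inv_of_mem hj v hrk,
          hb v j hj, h j hj, neg_zero, zero_add]
  by_cases hkn : k ≤ n
  · exact key k hkn le_rfl σ hσ h
  · have : σ = 1 := by
      have := level_anti (not_le.1 hkn).le hσ
      rwa [level_self, Subgroup.mem_bot] at this
    rw [this, map_one]

end kernel

/-! ### Elements of order `p` -/

section power

variable {p n k : ℕ}

theorem label_pow (σ : treeGroup p n) (i : Fin n) (x : Fin n → ZMod p) (m : ℕ) :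
    label (σ ^ m) i x = ∑ s ∈ Finset.range m, label σ i (σ ^ s • x) := by
  induction m with
  | zero => simp
  | succ m ih => rw [pow_succ', label_mul, ih, Finset.sum_range_succ, add_comm]

/-- In an element of order `p` of `level p n k` whose label at the vertex `v` of depth `k` is not
zero, the sums of the deeper labels below `v` vanish: every vertex below `v` is reached exactly
once as `σ ^ s • x` with `s < p` and `x` having letter `0` at position `k`, and the sum of the
labels along the orbit of `x` is the label of `σ ^ p = 1`. -/
theorem blockSum_eq_zero_of_pow_eq_one [Fact p.Prime] {i : Fin n} {k : Fin n} (hk : k < i)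
    {σ : treeGroup p n} (hσ : σ ∈ level p n k) (hp : σ ^ p = 1) {v : Fin n → ZMod p}
    (hv : label σ k v ≠ 0) : blockSum k i v σ = 0 := by
  classical
  set c := label σ k v
  have h1 : ∑ x ∈ block k i v, ∑ s ∈ Finset.range p,
      (if x k = 0 then label σ i (σ ^ s • x) else 0) = 0 := by
    refine Finset.sum_eq_zero fun x _ => ?_
    by_cases hx : x k = 0
    · simp only [hx, if_true]
      rw [← label_pow, hp, label_one]
    · simp [hx]
  have h2 : ∀ s : ℕ, ∑ x ∈ block k i v, (if x k = 0 then label σ i (σ ^ s • x) else 0) =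
      ∑ x ∈ block k i v, (if x k = s * c then label σ i x else 0) := by
    intro s
    have h3 := sum_block_smul (k := k) (i := i) hk.le v (σ ^ s)
      (g := fun x => if x k = s * c then label σ i x else 0) (fun x y h => by
        rw [h k hk, label_congr σ h])
    rw [block_congr i (pow_mem hσ s v)] at h3
    rw [← h3]
    refine Finset.sum_congr rfl fun x hx => ?_
    have : (σ ^ s • x) k = x k + s * c := by
      rw [smul_apply_eq, label_pow_of_mem_level hσ, label_congr σ (mem_block.1 hx).1]
    simp only [this, add_eq_right]
  rw [Finset.sum_comm, Finset.sum_congr rfl fun s _ => h2 s, Finset.sum_comm] at h1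
  rw [blockSum, ← h1]
  refine Finset.sum_congr rfl fun x _ => ?_
  rw [Finset.sum_eq_single (x k / c).val, ZMod.natCast_zmod_val, div_mul_cancel₀ _ hv, if_pos rfl]
  · intro s hs hne
    rw [if_neg]
    intro h
    refine hne ?_
    rw [h, mul_div_cancel_right₀ _ hv, ZMod.val_cast_of_lt (Finset.mem_range.1 hs)]
  · intro h
    exact absurd (Finset.mem_range.2 (ZMod.val_lt _)) h

end power

/-! ### Automorphisms of `p'`-order preserve the stabilizers of the depths -/

theorem mul_inv_mem_level_iff {p n k : ℕ} {σ τ : treeGroup p n} :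
    σ * τ⁻¹ ∈ level p n k ↔ ∀ x : Fin n → ZMod p, AgreeTo k (σ • x) (τ • x) := by
  rw [mem_level]
  refine ⟨fun h x => ?_, fun h x => ?_⟩
  · simpa [mul_smul] using h (τ • x)
  · simpa [mul_smul] using h (τ⁻¹ • x)

theorem label_eq_of_mul_inv_mem {p n : ℕ} {σ τ : treeGroup p n} {i : Fin n}
    (h : σ * τ⁻¹ ∈ level p n (i + 1)) (x : Fin n → ZMod p) : label σ i x = label τ i x := by
  rw [label, label, mul_inv_mem_level_iff.1 h x i (Nat.lt_succ_self _)]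

section invariance

open scoped Pointwise

variable {p n k : ℕ} [Fact p.Prime]

theorem rot_smul_of_not_agreeTo [DecidableEq (Fin n → ZMod p)] {i : Fin n} {v x : Fin n → ZMod p}
    (h : ¬ AgreeTo i x v) : rot i (Pi.single (trunc i v) 1) • x = x := by
  funext j
  rw [smul_apply_eq, label_rot, Pi.single_apply, if_neg fun h' => h (trunc_eq_iff.1 h'), ite_self,
    add_zero]

theorem label_rot_single [DecidableEq (Fin n → ZMod p)] (i : Fin n) (v x : Fin n → ZMod p)
    [Decidable (AgreeTo i x v)] :
    label (rot i (Pi.single (trunc i v) 1)) i x = if AgreeTo i x v then 1 else 0 := by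
  rw [label_rot_self, Pi.single_apply]
  exact if_congr trunc_eq_iff rfl rfl

/-- Modulo `level p n (i + 1)`, the subgroup `level p n i` contains its centralizer. -/
theorem mem_level_of_commute {i : Fin n} {σ : treeGroup p n}
    (h : ∀ b ∈ level p n i, σ * b * σ⁻¹ * b⁻¹ ∈ level p n (i + 1)) : σ ∈ level p n i := by
  classical
  intro v
  have h1 := label_eq_of_mul_inv_mem
    (h _ (rot_mem_level i (Pi.single (trunc i (σ • v)) 1))) (σ • v)
  rw [label_conj (rot_mem_level _ _), label_rot_single, label_rot_single,
    if_pos (AgreeTo.refl _ _)] at h1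
  by_contra hne
  rw [if_neg fun h' => hne h'.symm] at h1
  exact zero_ne_one h1

open Classical in
/-- The commutator of `b` with the unit rotation at `v` has labels `1` at `b • v` and `-1` at `v`;
it lies in `B`, hence commutes with `c ∈ B` modulo `level p n (i + 1)`. -/
theorem indicator_eq {i : Fin n} {B : Subgroup (treeGroup p n)} [B.Normal]
    (hB : ∀ a ∈ B, ∀ b ∈ B, a * b * a⁻¹ * b⁻¹ ∈ level p n (i + 1))
    {b c : treeGroup p n} (hb : b ∈ B) (hc : c ∈ B) (v x : Fin n → ZMod p) :
    ((if AgreeTo i (c • x) (b • v) then 1 else 0) - (if AgreeTo i (c • x) v then 1 else 0) : ZMod p)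
      = (if AgreeTo i x (b • v) then 1 else 0) - (if AgreeTo i x v then 1 else 0) := by
  set δ := rot i (Pi.single (trunc i v) 1) with hδ
  have hδl : δ ∈ level p n i := rot_mem_level _ _
  have hδi := inv_mem hδl
  have hconj := (level_normal p n i).conj_mem δ hδl b
  have hd : b * δ * b⁻¹ * δ⁻¹ ∈ B := by
    rw [mul_assoc, mul_assoc, ← mul_assoc δ]
    exact mul_mem hb (Subgroup.Normal.conj_mem inferInstance _ (inv_mem hb) δ)
  have hlab : ∀ y, label (b * δ * b⁻¹ * δ⁻¹) i y =
      (if AgreeTo i y (b • v) then 1 else 0) - (if AgreeTo i y v then 1 else 0) := by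
    intro y
    rw [label_mul_of_mem_level hδi, label_inv_of_mem_level hδl, label_rot_single, sub_eq_add_neg]
    congr 1
    rw [← smul_inv_smul b y, label_conj hδl, label_rot_single]
    refine if_congr ?_ rfl rfl
    rw [agreeTo_smul_iff]
  rw [← hlab, ← hlab, ← label_eq_of_mul_inv_mem (hB c hc _ hd),
    label_conj (mul_mem hconj hδi)]

/-- For odd `p`, `level p n i` is the largest normal subgroup that is abelian modulo
`level p n (i + 1)`. -/
theorem le_level_of_odd (hp : p ≠ 2) {i : Fin n} {B : Subgroup (treeGroup p n)} [B.Normal]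
    (hB : ∀ a ∈ B, ∀ b ∈ B, a * b * a⁻¹ * b⁻¹ ∈ level p n (i + 1)) : B ≤ level p n i := by
  classical
  intro b hb v
  by_contra hne
  have h := indicator_eq hB hb hb v v
  rw [if_pos (AgreeTo.refl _ _), if_neg hne, if_neg fun h' => hne h'.symm,
    if_pos (AgreeTo.refl _ _), sub_zero, zero_sub] at h
  have : Fact (2 < p) := ⟨(Fact.out : p.Prime).two_le.lt_of_ne' hp⟩
  exact ZMod.neg_one_ne_one h.symm

end invariance

section two

variable {n : ℕ}

/-- For `p = 2` and `i = j + 1`, the elements of `level 2 n j` whose labels at depth `i` agree on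
siblings. Modulo `level 2 n (i + 1)` they form, in the direct power of dihedral groups of order 8,
the direct power of the four-groups other than those of `level 2 n i`. -/
def IsDiagonalOnSiblings (i : Fin n) (j : Fin n) (σ : treeGroup 2 n) : Prop :=
  σ ∈ level 2 n j ∧ ∀ x y, AgreeTo j x y → label σ i x = label σ i y

theorem IsDiagonalOnSiblings.commute {i j : Fin n} (hij : (i : ℕ) = j + 1) {σ τ : treeGroup 2 n}
    (hσ : IsDiagonalOnSiblings i j σ) (hτ : IsDiagonalOnSiblings i j τ) :
    σ * τ * σ⁻¹ * τ⁻¹ ∈ level 2 n (i + 1) := by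
  rw [mul_assoc _ σ⁻¹, ← mul_inv_rev, mul_inv_mem_level_iff]
  intro x l hl
  rw [smul_apply_eq, smul_apply_eq, label_mul, label_mul, add_comm (label τ l _)]
  have key : ∀ {σ τ : treeGroup 2 n}, IsDiagonalOnSiblings i j σ → IsDiagonalOnSiblings i j τ →
      label σ l (τ • x) = label σ l x := by
    intro σ τ hσ hτ
    rcases Nat.lt_succ_iff_lt_or_eq.1 hl with hl' | hl'
    · exact label_congr σ ((hτ.1 x).mono (by omega))
    · obtain rfl : l = i := Fin.ext hl'
      exact hσ.2 _ _ (hτ.1 x)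
  rw [key hσ hτ, key hτ hσ]

/-- For `p = 2` there is only one candidate other than `level 2 n i` for the image of `level 2 n i`
under an automorphism. By `indicator_eq`, an element `b ∈ B` that moves a vertex `v` at depth `i`
determines the `B`-orbit `{v, b • v}`, and the rotation at the parent of `b • v` shows that `b • v`
is the sibling of `v`. -/
theorem isDiagonalOnSiblings_of_mem {i j : Fin n} (hij : (i : ℕ) = j + 1)
    {B : Subgroup (treeGroup 2 n)} [B.Normal]
    (hB : ∀ a ∈ B, ∀ b ∈ B, a * b * a⁻¹ * b⁻¹ ∈ level 2 n (i + 1))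
    (hB2 : ∀ b ∈ B, b * b ∈ level 2 n (i + 1)) (hne : ¬ B ≤ level 2 n i)
    {b : treeGroup 2 n} (hb : b ∈ B) : IsDiagonalOnSiblings i j b := by
  classical
  have h1 : ∀ b ∈ B, ∀ c ∈ B, ∀ v : Fin n → ZMod 2, ¬ AgreeTo i (b • v) v →
      AgreeTo i (c • v) (b • v) ∨ AgreeTo i (c • v) v := by
    intro b hb c hc v hbv
    have h := indicator_eq hB hb hc v v
    by_contra hcon
    rw [not_or] at hcon
    rw [if_neg hcon.1, if_neg hcon.2, if_neg fun h' => hbv h'.symm,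
      if_pos (AgreeTo.refl _ _)] at h
    exact absurd h (by decide)
  have h2 : ∀ v : Fin n → ZMod 2, ∃ b ∈ B, ¬ AgreeTo i (b • v) v := by
    intro v
    obtain ⟨b, hb, hbl⟩ := SetLike.not_le_iff_exists.1 hne
    obtain ⟨v₀, hv₀⟩ := not_forall.1 hbl
    obtain ⟨τ, rfl⟩ := MulAction.exists_smul_eq (treeGroup 2 n) v₀ v
    refine ⟨τ * b * τ⁻¹, Subgroup.Normal.conj_mem inferInstance b hb τ, ?_⟩
    rwa [mul_smul, mul_smul, inv_smul_smul, agreeTo_smul_iff]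
  have h3 : ∀ b ∈ B, b ∈ level 2 n j := by
    intro b hb v
    by_contra hbv
    set s := rot j (Pi.single (trunc j (b • v)) 1) with hs
    have hsv : s⁻¹ • v = v := by
      rw [inv_smul_eq_iff, hs, rot_smul_of_not_agreeTo fun h => hbv h.symm]
    have hji : (j : ℕ) < i := by omega
    have := h1 b hb _ (Subgroup.Normal.conj_mem inferInstance b hb s) v fun h =>
      hbv (h.mono hji.le)
    rw [mul_smul, mul_smul, hsv] at this
    rcases this with h | h
    · have h' := (smul_agreeTo_iff s).1 h j hji
      rw [hs, label_rot_single, if_pos (AgreeTo.refl _ _)] at h'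
      exact one_ne_zero h'
    · exact hbv (((rot_mem_level j _ (b • v)).symm).trans (h.mono hji.le))
  refine ⟨h3 b hb, fun x y hxy => ?_⟩
  have htwo : ∀ a b c : ZMod 2, a ≠ b → c ≠ b → a = c := by decide
  have hsib : ∀ c ∈ B, ¬ AgreeTo i (c • x) x → ¬ AgreeTo i x y → AgreeTo i (c • x) y := by
    intro c hc hcx hxy' l hl
    have hagree := h3 c hc x
    rcases (Nat.lt_succ_iff_lt_or_eq.1 (hij ▸ hl)) with hl' | hl'
    · exact (hagree.trans hxy) l hl'
    · obtain rfl : l = j := Fin.ext hl'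
      have aux : ∀ z : Fin n → ZMod 2, AgreeTo l z x → ¬ AgreeTo i z x → z l ≠ x l := by
        intro z hz hz' heq
        refine hz' fun m hm => ?_
        rcases (Nat.lt_succ_iff_lt_or_eq.1 (hij ▸ hm)) with hm' | hm'
        · exact hz m hm'
        · obtain rfl : m = l := Fin.ext hm'
          exact heq
      exact htwo _ _ _ (aux _ hagree hcx) (aux _ hxy.symm fun h => hxy' h.symm)
  by_cases hxy' : AgreeTo i x y
  · exact label_congr b hxy'
  by_cases hbx : AgreeTo i (b • x) x
  · obtain ⟨c, hc, hcx⟩ := h2 x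
    have h4 := hB b hb c hc
    rw [mul_assoc _ b⁻¹, ← mul_inv_rev] at h4
    have h5 := label_eq_of_mul_inv_mem h4 x
    rw [label_mul, label_mul, label_congr c hbx, add_comm, add_left_cancel_iff,
      label_congr b (hsib c hc hcx hxy')] at h5
    exact h5.symm
  · have h4 := mem_level_iff_label.1 (hB2 b hb) i (Nat.lt_succ_self _) x
    rw [label_mul, label_congr b (hsib b hb hbx hxy')] at h4
    rw [← add_eq_zero_iff_eq_neg.1 h4 |>.trans (ZMod.neg_eq_self_mod_two _)]

end two

section automorphism

open scoped Pointwise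

variable {p n k : ℕ} [Fact p.Prime]

theorem commutator_mem_level_succ {i : Fin n} {a b : treeGroup p n} (ha : a ∈ level p n i)
    (hb : b ∈ level p n i) : a * b * a⁻¹ * b⁻¹ ∈ level p n (i + 1) := by
  rw [mul_assoc _ a⁻¹, ← mul_inv_rev, mul_inv_mem_level_iff]
  intro x l hl
  rw [smul_apply_eq, smul_apply_eq, label_mul, label_mul, add_comm (label b l _),
    label_congr a ((hb x).mono (Nat.lt_succ_iff.1 hl)),
    label_congr b ((ha x).mono (Nat.lt_succ_iff.1 hl))]

/-- A `p'`-group of automorphisms preserves the stabilizers of all depths. If `p = 2`, an element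
`g` moving one of them would have the same effect on it as `g⁻¹`, so that `g ^ 2`, and hence the
element `g` of odd order, would fix it. -/
theorem smul_level_eq {G : Type*} [Group G] [Finite G] (hG : ¬ p ∣ Nat.card G)
    (φ : G →* MulAut (treeGroup p n)) (k : ℕ) (g : G) : φ g • level p n k = level p n k := by
  suffices H : ∀ m ≤ n, ∀ g, φ g • level p n m = level p n m by
    by_cases hk : k ≤ n
    · exact H k hk g
    · have : level p n k = ⊥ := eq_bot_iff.2 (level_self (p := p) (n := n) ▸
        level_anti (not_le.1 hk).le)
      rw [this]
      exact Subgroup.smul_bot _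
  intro m hm
  induction hm using Nat.decreasingInduction with
  | self => intro g; rw [level_self]; exact Subgroup.smul_bot _
  | of_succ m hm ih =>
    let i : Fin n := ⟨m, hm⟩
    change ∀ g, φ g • level p n i = level p n i
    have ih' : ∀ g σ, φ g σ ∈ level p n (i + 1) ↔ σ ∈ level p n (i + 1) := by
      intro g σ
      conv_lhs => rw [← ih g]
      exact Subgroup.smul_mem_pointwise_smul_iff
    have hmem : ∀ g σ, σ ∈ φ g • level p n i ↔ ∃ d ∈ level p n i, φ g d = σ := fun g σ =>
      Subgroup.mem_smul_pointwise_iff_exists _ _ _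
    have hcomm : ∀ g, ∀ a ∈ φ g • level p n i, ∀ b ∈ φ g • level p n i,
        a * b * a⁻¹ * b⁻¹ ∈ level p n (i + 1) := by
      intro g a ha b hb
      obtain ⟨a, ha', rfl⟩ := (hmem g _).1 ha
      obtain ⟨b, hb', rfl⟩ := (hmem g _).1 hb
      simpa using (ih' g _).2 (commutator_mem_level_succ ha' hb')
    have hnormal : ∀ g, (φ g • level p n i).Normal := fun g => ⟨fun a ha τ => by
      obtain ⟨a, ha', rfl⟩ := (hmem g _).1 ha
      refine (hmem g _).2 ⟨(φ g)⁻¹ τ * a * ((φ g)⁻¹ τ)⁻¹,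
        (level_normal p n i).conj_mem _ ha' _, ?_⟩
      simp⟩
    have heq : ∀ g, φ g • level p n i ≤ level p n i → φ g • level p n i = level p n i := by
      intro g hg
      refine Subgroup.eq_of_le_of_card_ge hg (le_of_eq ?_)
      exact (Nat.card_congr (Subgroup.equivSMul (φ g) (level p n i)).toEquiv)
    by_cases hp : p = 2
    · subst hp
      have hcent : ∀ g σ, (∀ b ∈ φ g • level 2 n i, σ * b * σ⁻¹ * b⁻¹ ∈ level 2 n (i + 1)) →
          σ ∈ φ g • level 2 n i := by
        intro g σ h
        refine (hmem g _).2 ⟨(φ g)⁻¹ σ, mem_level_of_commute fun b hb => ?_, by simp⟩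
        have := (ih' g⁻¹ _).2 (h (φ g b) ((hmem g _).2 ⟨b, hb, rfl⟩))
        simpa using this
      by_contra hcon
      obtain ⟨g, hg⟩ := not_forall.1 hcon
      have hi : i ≠ ⟨0, i.pos⟩ := by
        intro h
        refine hg ?_
        rw [h]
        change φ g • level 2 n 0 = level 2 n 0
        rw [level_zero]
        exact eq_top_iff.2 fun σ _ => (Subgroup.mem_smul_pointwise_iff_exists _ _ _).2
          ⟨(φ g)⁻¹ σ, Subgroup.mem_top _, by simp⟩
      have hipos : 0 < (i : ℕ) := Nat.pos_of_ne_zero fun h => hi (Fin.ext h)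
      let j : Fin n := ⟨i - 1, by omega⟩
      have hij : (i : ℕ) = j + 1 := by simp only [j]; omega
      have hdiag : ∀ g, φ g • level 2 n i ≠ level 2 n i → ∀ b ∈ φ g • level 2 n i,
          IsDiagonalOnSiblings i j b := by
        intro g hg b hb
        have := hnormal g
        refine isDiagonalOnSiblings_of_mem hij (hcomm g) ?_ (fun h => hg (heq g h)) hb
        intro b hb
        obtain ⟨b, hb', rfl⟩ := (hmem g _).1 hb
        rw [← map_mul, ih']
        refine (mem_level_succ_iff i.2 (mul_mem hb' hb')).2 fun x => ?_
        rw [label_mul_of_mem_level hb']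
        exact CharTwo.add_self_eq_zero _
      have hle : ∀ g h, φ g • level 2 n i ≠ level 2 n i → φ h • level 2 n i ≠ level 2 n i →
          φ g • level 2 n i ≤ φ h • level 2 n i := fun g h hg hh b hb =>
        hcent h b fun c hc => (hdiag g hg b hb).commute hij (hdiag h hh c hc)
      have hg' : φ g⁻¹ • level 2 n i ≠ level 2 n i := by
        intro h
        rw [map_inv, inv_smul_eq_iff] at h
        exact hg h.symm
      have h2 : φ (g ^ 2) ∈ MulAction.stabilizer (MulAut (treeGroup 2 n)) (level 2 n i) := by
        have := le_antisymm (hle g g⁻¹ hg hg') (hle g⁻¹ g hg' hg)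
        rw [map_inv, eq_inv_smul_iff, ← mul_smul, ← map_mul, ← pow_two] at this
        exact this
      have hodd : Odd (orderOf g) := by
        rw [← Nat.not_even_iff_odd, even_iff_two_dvd]
        exact fun h => hG (h.trans (orderOf_dvd_natCard g))
      obtain ⟨m, hm⟩ := hodd
      have : g = (g ^ 2) ^ (m + 1) := by
        rw [← pow_mul, show 2 * (m + 1) = orderOf g + 1 by omega, pow_succ, pow_orderOf_eq_one,
          one_mul]
      rw [this, map_pow] at hg
      exact hg (pow_mem h2 _)
    · intro g
      have := hnormal g
      exact heq g (le_level_of_odd hp (hcomm g))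

end automorphism

/-! ### Sylow subgroups of the symmetric group -/

section card

variable {p n : ℕ}

/-- An element of `treeGroup p n` is the same as a family of labels. -/
noncomputable def treeGroupEquivLabels (p n : ℕ) [NeZero p] :
    treeGroup p n ≃ ∀ i : Fin n, (Fin i → ZMod p) → ZMod p where
  toFun σ i y := label σ i fun j => if h : (j : ℕ) < i then y ⟨j, h⟩ else 0
  invFun f := ofLabel (fun i x => f i fun j => x (Fin.castLE i.2.le j)) fun i x y h => by
    congr 1
    funext j
    exact h _ j.2
  left_inv σ := treeGroup_ext fun i x => by
    rw [label_ofLabel]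
    refine label_congr σ fun j hj => ?_
    simp [hj]
  right_inv f := by
    funext i y
    change label (ofLabel _ _) i _ = _
    rw [label_ofLabel]
    congr 1
    funext j
    simp

theorem card_treeGroup (p n : ℕ) [NeZero p] :
    Nat.card (treeGroup p n) = p ^ ∑ i ∈ Finset.range n, p ^ i := by
  rw [Nat.card_congr (treeGroupEquivLabels p n), Nat.card_pi, ← Finset.prod_pow_eq_pow_sum,
    Finset.prod_range]
  simp

theorem isPGroup_treeGroup (p n : ℕ) [Fact p.Prime] : IsPGroup p (treeGroup p n) :=
  IsPGroup.of_card (card_treeGroup p n)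

theorem nonempty_sylow_mulEquiv_treeGroup {p n : ℕ} [hp : Fact p.Prime]
    (P : Sylow p (Perm (Fin (p ^ n)))) : Nonempty (P ≃* treeGroup p n) := by
  have e : (Fin n → ZMod p) ≃ Fin (p ^ n) := Finite.equivFinOfCardEq (by simp)
  have f := e.permCongrHom.subgroupMap (treeGroup p n)
  let P' : Sylow p (Perm (Fin (p ^ n))) :=
    Sylow.ofCard ((treeGroup p n).map (e.permCongrHom : Perm (Fin n → ZMod p) →* _)) (by
      rw [← Nat.card_congr f.toEquiv, card_treeGroup, Nat.card_perm, Nat.card_fin,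
        ← Nat.multiplicity_eq_factorization hp.out (p ^ n).factorial_ne_zero,
        Nat.Prime.multiplicity_factorial_pow hp.out])
  exact ⟨(P.equiv P').trans f.symm⟩

end card

/-! ### Conjugacy of complements and generation modulo the commutator subgroup -/

section conj

/-- Two homomorphisms from `G` that agree modulo an abelian normal subgroup `K` of order prime to
that of `G` are conjugate under `K`: the crossed homomorphism `g ↦ φ g * (t g)⁻¹` is made principal
by averaging it over `G`. -/
theorem exists_conj_of_commute {Γ G : Type*} [Group Γ] [Group G] [Finite G] {φ t : G →* Γ}
    {K : Subgroup Γ} [K.Normal] (hcard : Nat.card K ≠ 0)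
    (hcop : (Nat.card K).Coprime (Nat.card G))
    (hK : ∀ a ∈ K, ∀ b ∈ K, a * b = b * a)
    (h : ∀ g, φ g * (t g)⁻¹ ∈ K) : ∃ x ∈ K, ∀ g, φ g = x⁻¹ * t g * x := by
  have : Fintype G := Fintype.ofFinite G
  let _ : CommGroup K :=
    { (inferInstance : Group K) with mul_comm := fun a b => Subtype.ext (hK a a.2 b b.2) }
  let c : G → K := fun g => ⟨φ g * (t g)⁻¹, h g⟩
  have hc : ∀ g h, MulAut.conjNormal (φ g) (c h) = c (g * h) * (c g)⁻¹ := by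
    intro g h
    apply Subtype.ext
    simp only [c, MulAut.conjNormal_apply, map_mul, Subgroup.coe_mul, Subgroup.coe_inv]
    group
  obtain ⟨m, hm⟩ : ∃ m, ∀ a : K, (a ^ Nat.card G) ^ m = a := by
    obtain ⟨m, -, hm⟩ := Nat.exists_mul_mod_eq_of_coprime 1 hcop.symm hcard
    refine ⟨m, fun a => ?_⟩
    rw [← pow_mul, ← pow_mod_natCard, hm, pow_mod_natCard, pow_one]
  set y : K := ∏ h, c h with hy
  have h1 : ∀ g, MulAut.conjNormal (φ g) y = y * ((c g) ^ Nat.card G)⁻¹ := by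
    intro g
    rw [hy, map_prod, Finset.prod_congr rfl fun h _ => hc g h, Finset.prod_mul_distrib,
      Finset.prod_const, Finset.card_univ, Fintype.card_eq_nat_card, inv_pow]
    congr 1
    exact Fintype.prod_equiv (Equiv.mulLeft g) _ _ fun _ => rfl
  have h2 : ∀ g, MulAut.conjNormal (φ g) (y ^ m) = y ^ m * (c g)⁻¹ := by
    intro g
    rw [map_pow, h1, mul_pow, inv_pow, hm]
  refine ⟨((y ^ m : K) : Γ)⁻¹, inv_mem (y ^ m).2, fun g => ?_⟩
  have h3 := congrArg (Subtype.val) (h2 g)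
  simp only [MulAut.conjNormal_apply, Subgroup.coe_mul, Subgroup.coe_inv, c] at h3
  generalize ((y ^ m : K) : Γ) = z at h3 ⊢
  rw [mul_inv_rev, inv_inv, ← mul_assoc] at h3
  rw [inv_inv]
  exact (eq_mul_inv_iff_mul_eq.2 (mul_right_cancel h3)).trans (by simp)

/-- Two homomorphisms from a `p'`-group that agree modulo a finite normal `p`-subgroup `K` are
conjugate under `K`. -/
theorem exists_conj_of_isPGroup {p : ℕ} [Fact p.Prime] {Γ G : Type*} [Group Γ] [Group G] [Finite G]
    (hG : ¬ p ∣ Nat.card G) {φ t : G →* Γ} {K : Subgroup Γ} [K.Normal] [Finite K]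
    (hK : IsPGroup p K) (h : ∀ g, φ g * (t g)⁻¹ ∈ K) : ∃ x ∈ K, ∀ g, φ g = x⁻¹ * t g * x := by
  induction hN : Nat.card K using Nat.strong_induction_on generalizing Γ with
  | _ N ih =>
  subst hN
  rcases subsingleton_or_nontrivial K with hs | hs
  · refine ⟨1, one_mem _, fun g => ?_⟩
    have := congrArg Subtype.val (Subsingleton.elim (⟨_, h g⟩ : K) 1)
    rw [inv_one, one_mul, mul_one]
    exact mul_inv_eq_one.1 this
  let Z : Subgroup Γ := (Subgroup.center K).map K.subtype
  have hZK : Z ≤ K := Subgroup.map_subtype_le _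
  have hZn : Z.Normal := inferInstance
  have hZc : ∀ a ∈ Z, ∀ b ∈ K, a * b = b * a := by
    rintro _ ⟨a, ha, rfl⟩ b hb
    exact congrArg Subtype.val (Subgroup.mem_center_iff.1 ha ⟨b, hb⟩).symm
  let π := QuotientGroup.mk' Z
  let K' : Subgroup (Γ ⧸ Z) := K.map π
  have hK'n : K'.Normal := Subgroup.Normal.map inferInstance π (QuotientGroup.mk'_surjective Z)
  have hsurj := (π.subgroupMap_surjective K)
  have hK'f : Finite K' := Finite.of_surjective _ hsurj
  have hlt : Nat.card K' < Nat.card K := by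
    by_contra hle
    have hinj := (hsurj.bijective_of_nat_card_le (not_lt.1 hle)).1
    have := hK.center_nontrivial
    obtain ⟨z, hz⟩ := exists_ne (1 : Subgroup.center K)
    refine hz (Subtype.ext (hinj (Subtype.ext ?_)))
    change π ((z : K) : Γ) = π 1
    rw [map_one]
    exact (QuotientGroup.eq_one_iff _).2 ⟨z, z.2, rfl⟩
  obtain ⟨x', ⟨x, hx, rfl⟩, hx'⟩ := ih _ hlt (φ := π.comp φ) (t := π.comp t) (K := K')
    (hK.of_surjective _ hsurj) (fun g => ⟨_, h g, by simp⟩) rfl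
  have hZf : Finite Z := Finite.Set.subset (K : Set Γ) hZK
  have hZcard : Nat.card Z ≠ 0 := Nat.card_pos.ne'
  have hZcop : (Nat.card Z).Coprime (Nat.card G) := by
    obtain ⟨m, hm⟩ := IsPGroup.iff_card.1 (hK.to_le hZK)
    rw [hm]
    exact Nat.Coprime.pow_left _ ((Nat.Prime.coprime_iff_not_dvd Fact.out).2 hG)
  obtain ⟨z, hz, hz'⟩ := exists_conj_of_commute (φ := (MulAut.conj x).toMonoidHom.comp φ) (t := t)
    (K := Z) hZcard hZcop (fun a ha b hb => hZc a ha b (hZK hb)) (fun g => by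
      refine (QuotientGroup.eq_one_iff _).1 ?_
      have := hx' g
      simp only [MonoidHom.comp_apply] at this
      change π (x * φ g * x⁻¹ * (t g)⁻¹) = 1
      simp only [map_mul, map_inv, this]
      group)
  refine ⟨z * x, mul_mem (hZK hz) hx, fun g => ?_⟩
  have h1 : x * φ g * x⁻¹ = z⁻¹ * t g * z := hz' g
  rw [mul_inv_rev, mul_assoc x⁻¹, ← mul_assoc, mul_assoc x⁻¹, mul_assoc x⁻¹, ← h1]
  group

/-- The commutator subgroup of a finite nilpotent group consists of non-generators. -/
theorem eq_top_of_sup_commutator_eq_top {P : Type*} [Group P] [Finite P] [Group.IsNilpotent P]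
    {C : Subgroup P} (h : C ⊔ commutator P = ⊤) : C = ⊤ := by
  by_contra hC
  obtain ⟨M, hM, hCM⟩ := (eq_top_or_exists_le_coatom C).resolve_left hC
  have hMn : M.Normal := Subgroup.NormalizerCondition.normal_of_coatom M
    Group.normalizerCondition_of_isNilpotent hM
  have hnt : Nontrivial (P ⧸ M) := QuotientGroup.nontrivial_iff.2 hM.1
  have hsol : Group.IsSolvable (P ⧸ M) := inferInstance
  have h1 := congrArg (Subgroup.map (QuotientGroup.mk' M)) h
  rw [Subgroup.map_sup, (Subgroup.map_eq_bot_iff _).2 (by rwa [QuotientGroup.ker_mk']), bot_sup_eq,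
    commutator_def, Subgroup.map_commutator,
    Subgroup.map_top_of_surjective _ (QuotientGroup.mk'_surjective M), ← commutator_def] at h1
  exact (Group.IsSolvable.commutator_lt_top_of_nontrivial (P ⧸ M)).ne h1

end conj

/-! ### The torus -/

section torus

variable {p n k : ℕ}

theorem agreeTo_units_smul (t : (Fin n → ZMod p)ˣ) {x y : Fin n → ZMod p} (h : AgreeTo k x y) :
    AgreeTo k (t • x) (t • y) := fun j hj => by
  simp only [Units.smul_def, smul_eq_mul, Pi.mul_apply, h j hj]

/-- The conjugate of `σ` by the permutation of words that multiplies the `i`-th letter by `t i`. -/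
def scale (t : (Fin n → ZMod p)ˣ) (σ : treeGroup p n) : treeGroup p n :=
  ⟨MulAction.toPerm t * σ.1 * MulAction.toPerm t⁻¹, fun i x y h => by
    have h1 := σ.2 i (t⁻¹ • x) (t⁻¹ • y) (agreeTo_units_smul t⁻¹ h)
    have h2 : ∀ z : Fin n → ZMod p, (t • σ.1 (t⁻¹ • z)) i - z i =
        t.val i * (σ.1 (t⁻¹ • z) i - (t⁻¹ • z) i) := by
      intro z
      rw [mul_sub]
      conv_lhs => rw [← smul_inv_smul t z]
      simp [Units.smul_def]
    change (t • σ.1 (t⁻¹ • x)) i - x i = (t • σ.1 (t⁻¹ • y)) i - y i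
    rw [h2, h2, h1]⟩

theorem scale_smul (t : (Fin n → ZMod p)ˣ) (σ : treeGroup p n) (x : Fin n → ZMod p) :
    scale t σ • x = t • σ • t⁻¹ • x := rfl

theorem label_scale (t : (Fin n → ZMod p)ˣ) (σ : treeGroup p n) (i : Fin n) (x : Fin n → ZMod p) :
    label (scale t σ) i x = t.val i * label σ i (t⁻¹ • x) := by
  rw [label, label, scale_smul, mul_sub]
  conv_lhs => rw [← smul_inv_smul t x]
  simp [Units.smul_def]

/-- The torus `(F_p^×)^n`, acting on `treeGroup p n` by automorphisms. -/
def torus (p n : ℕ) : (Fin n → ZMod p)ˣ →* MulAut (treeGroup p n) where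
  toFun t :=
    { toFun := scale t
      invFun := scale t⁻¹
      left_inv := fun σ => treeGroup_ext_smul fun x => by simp [scale_smul]
      right_inv := fun σ => treeGroup_ext_smul fun x => by simp [scale_smul]
      map_mul' := fun σ τ => treeGroup_ext_smul fun x => by simp [scale_smul, mul_smul] }
  map_one' := MulEquiv.ext fun σ => treeGroup_ext_smul fun x => by simp [scale_smul]
  map_mul' s t := MulEquiv.ext fun σ => treeGroup_ext_smul fun x => by
    simp [scale_smul, mul_smul]

theorem scale_mem_level (t : (Fin n → ZMod p)ˣ) {σ : treeGroup p n} (hσ : σ ∈ level p n k) :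
    scale t σ ∈ level p n k :=
  mem_level_iff_label.2 fun i hi x => by rw [label_scale, mem_level_iff_label.1 hσ i hi, mul_zero]

theorem blockSum_scale [NeZero p] (t : (Fin n → ZMod p)ˣ) (σ : treeGroup p n) (i : Fin n)
    (v : Fin n → ZMod p) :
    blockSum k i v (scale t σ) = t.val i * blockSum k i (t⁻¹ • v) σ := by
  have hz : ∀ (s : (Fin n → ZMod p)ˣ) (x : Fin n → ZMod p), (∀ j : Fin n, i ≤ j → x j = 0) →
      ∀ j : Fin n, i ≤ j → (s • x) j = 0 := by
    intro s x h j hj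
    simp [Units.smul_def, h j hj]
  simp only [blockSum, label_scale, ← Finset.mul_sum]
  congr 1
  refine Finset.sum_nbij' (fun x => t⁻¹ • x) (fun x => t • x) ?_ ?_
    (fun x _ => smul_inv_smul t x) (fun x _ => inv_smul_smul t x) (fun _ _ => rfl)
  · intro x hx
    rw [mem_block] at hx ⊢
    exact ⟨agreeTo_units_smul _ hx.1, hz _ _ hx.2⟩
  · intro x hx
    rw [mem_block] at hx ⊢
    exact ⟨by simpa using agreeTo_units_smul t hx.1, hz _ _ hx.2⟩

end torus

/-! ### The diagonal part of an automorphism -/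

section total

variable {p n : ℕ}

/-- The sum of all labels at depth `i`, as a homomorphism. -/
noncomputable def totalSum (p n : ℕ) [NeZero p] (i : Fin n) :
    treeGroup p n →* Multiplicative (ZMod p) where
  toFun σ := Multiplicative.ofAdd (blockSum 0 i 0 σ)
  map_one' := by rw [blockSum_one]; rfl
  map_mul' σ τ := by
    rw [blockSum_mul_of_mem (Nat.zero_le _) _ _ (by rw [level_zero]; exact Subgroup.mem_top _)]
    rfl

/-- The sum of all labels at depth `i`. -/
noncomputable def total [NeZero p] (i : Fin n) (σ : treeGroup p n) : ZMod p :=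
  (totalSum p n i σ).toAdd

theorem total_eq [NeZero p] (i : Fin n) (σ : treeGroup p n) : total i σ = blockSum 0 i 0 σ := rfl

theorem total_mul [NeZero p] (i : Fin n) (σ τ : treeGroup p n) :
    total i (σ * τ) = total i σ + total i τ := by simp [total]

theorem total_inv [NeZero p] (i : Fin n) (σ : treeGroup p n) :
    total i σ⁻¹ = - total i σ := by simp [total]

theorem total_pow [NeZero p] (i : Fin n) (σ : treeGroup p n) (m : ℕ) :
    total i (σ ^ m) = m * total i σ := by simp [total]

theorem total_of_mem_commutator [NeZero p] (i : Fin n) {σ : treeGroup p n}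
    (h : σ ∈ commutator (treeGroup p n)) : total i σ = 0 := by
  have : totalSum p n i σ = 1 := Abelianization.commutator_subset_ker (totalSum p n i) h
  rw [total, this, toAdd_one]

theorem mem_commutator_of_total [NeZero p] {σ : treeGroup p n} (h : ∀ i, total i σ = 0) :
    σ ∈ commutator (treeGroup p n) := by
  rw [← Abelianization.ker_of, MonoidHom.mem_ker]
  refine map_eq_one_of_blockSum (k := 0) (fun a _ b _ => Commute.all _ _)
    (by rw [level_zero]; exact Subgroup.mem_top _) fun i _ v => ?_
  rw [blockSum_congr (w := 0) fun j hj => absurd hj (Nat.not_lt_zero _)]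
  exact h i

theorem total_of_mem_level [NeZero p] {i : Fin n} {k : ℕ} (hi : i < k) {σ : treeGroup p n}
    (h : σ ∈ level p n k) : total i σ = 0 :=
  blockSum_eq_zero_of_mem _ hi h

theorem exists_total_eq [NeZero p] (m : Fin n → ZMod p) :
    ∃ σ : treeGroup p n, (∀ i, total i σ = m i) ∧ ∀ i, m i = 0 → ∀ x, label σ i x = 0 := by
  classical
  refine ⟨ofLabel (fun i x => if ∀ j : Fin n, j < i → x j = 0 then m i else 0) ?_, ?_, ?_⟩
  · intro i x y h
    refine if_congr (forall_congr' fun j => ?_) rfl rfl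
    exact ⟨fun h1 h2 => (h j h2) ▸ h1 h2, fun h1 h2 => (h j h2) ▸ h1 h2⟩
  · intro i
    rw [total_eq, blockSum, Finset.sum_eq_single 0]
    · rw [label_ofLabel]
      exact if_pos fun _ _ => rfl
    · intro x hx hne
      rw [mem_block] at hx
      rw [label_ofLabel, if_neg]
      intro h
      refine hne (funext fun j => ?_)
      by_cases hj : j < i
      · exact h j hj
      · exact hx.2 j (not_lt.1 hj)
    · intro h
      exact absurd (mem_block.2 ⟨AgreeTo.refl _ _, fun _ _ => rfl⟩) h
  · intro i hi x
    rw [label_ofLabel, hi, ite_self]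

theorem exists_mem_level_total_eq_one [Fact p.Prime] (k : Fin n) :
    ∃ a ∈ level p n k, total k a = 1 := by
  classical
  obtain ⟨a, ha, ha'⟩ := exists_total_eq (p := p) (Pi.single k 1)
  refine ⟨a, mem_level_iff_label.2 fun i hi => ha' i ?_, by simp [ha]⟩
  rw [Pi.single_apply, if_neg]
  rintro rfl
  exact lt_irrefl _ hi

end total

section automorphism

open scoped Pointwise

variable {p n : ℕ}

/-- The automorphisms that preserve the stabilizers of all depths. -/
def levelAut (p n : ℕ) : Subgroup (MulAut (treeGroup p n)) :=
  ⨅ k, MulAction.stabilizer (MulAut (treeGroup p n)) (level p n k)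

theorem apply_mem_level {α : MulAut (treeGroup p n)} (hα : α ∈ levelAut p n) {k : ℕ}
    {σ : treeGroup p n} (hσ : σ ∈ level p n k) : α σ ∈ level p n k := by
  have : α • level p n k = level p n k := (Subgroup.mem_iInf.1 hα k)
  rw [← this]
  exact Subgroup.smul_mem_pointwise_smul _ _ _ hσ

variable [Fact p.Prime]

/-- Modulo commutators, `d` can be replaced by an element of `level p n (k + 1)`, which `α`
preserves. -/
theorem total_apply_eq_zero {α : MulAut (treeGroup p n)} (hα : α ∈ levelAut p n) {k : Fin n}
    {d : treeGroup p n} (hd : d ∈ level p n k) (h0 : total k d = 0) : total k (α d) = 0 := by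
  obtain ⟨s, hs, hs'⟩ := exists_total_eq fun i => total i d
  have hsl : s ∈ level p n (k + 1) := mem_level_iff_label.2 fun i hi => hs' i (by
    rcases Nat.lt_succ_iff_lt_or_eq.1 hi with hi' | hi'
    · exact total_of_mem_level hi' hd
    · rw [Fin.ext hi', h0])
  have hc : s⁻¹ * d ∈ commutator (treeGroup p n) := mem_commutator_of_total fun i => by
    rw [total_mul, total_inv, hs, neg_add_cancel]
  have h1 : α (s⁻¹ * d) ∈ commutator (treeGroup p n) :=
    (Subgroup.characteristic_iff_le_comap.1 inferInstance α) hc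
  have h2 := total_of_mem_commutator k h1
  rwa [map_mul, total_mul, map_inv, total_inv,
    total_of_mem_level k.val.lt_succ_self (apply_mem_level hα hsl), neg_zero, zero_add] at h2

/-- An element of `level p n k` whose labels at depth `k` have sum `1`. -/
noncomputable def levelGen (p : ℕ) {n : ℕ} [Fact p.Prime] (k : Fin n) : treeGroup p n :=
  (exists_mem_level_total_eq_one (p := p) k).choose

theorem levelGen_mem (k : Fin n) : levelGen p k ∈ level p n k :=
  (exists_mem_level_total_eq_one (p := p) k).choose_spec.1

theorem total_levelGen (k : Fin n) : total k (levelGen p k) = 1 :=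
  (exists_mem_level_total_eq_one (p := p) k).choose_spec.2

/-- On the image of `level p n k` under the sum of the labels at depth `k`, an automorphism acts as
a scalar. -/
theorem total_apply {α : MulAut (treeGroup p n)} (hα : α ∈ levelAut p n) {k : Fin n}
    {d : treeGroup p n} (hd : d ∈ level p n k) :
    total k (α d) = total k (α (levelGen p k)) * total k d := by
  have h := total_apply_eq_zero hα (k := k)
    (d := (levelGen p k ^ (total k d).val)⁻¹ * d)
    (mul_mem (inv_mem (pow_mem (levelGen_mem k) _)) hd) (by
      rw [total_mul, total_inv, total_pow, total_levelGen, ZMod.natCast_zmod_val, mul_one,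
        neg_add_cancel])
  rw [map_mul, map_inv, map_pow, total_mul, total_inv, total_pow, ZMod.natCast_zmod_val] at h
  rw [mul_comm, eq_comm, ← neg_add_eq_zero, h]

/-- The scalars by which an automorphism acts on the factors of the abelianization `(F_p)^n` of
`treeGroup p n` that are given by the depths. -/
noncomputable def diagPart (p n : ℕ) [Fact p.Prime] : levelAut p n →* (Fin n → ZMod p)ˣ :=
  MonoidHom.toHomUnits
    { toFun := fun α k => total k (α.1 (levelGen p k))
      map_one' := funext fun k => total_levelGen k
      map_mul' := fun α β => funext fun k => by
        change total k (α.1 (β.1 (levelGen p k))) = _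
        rw [total_apply α.2 (apply_mem_level β.2 (levelGen_mem k))]
        rfl }

theorem diagPart_apply (α : levelAut p n) (k : Fin n) :
    (diagPart p n α).val k = total k (α.1 (levelGen p k)) := rfl

theorem torus_mem_levelAut (t : (Fin n → ZMod p)ˣ) : torus p n t ∈ levelAut p n := by
  refine Subgroup.mem_iInf.2 fun k => ?_
  rw [MulAction.mem_stabilizer_iff]
  refine le_antisymm ?_ ?_
  · intro σ hσ
    obtain ⟨τ, hτ, rfl⟩ := (Subgroup.mem_smul_pointwise_iff_exists _ _ _).1 hσ
    exact scale_mem_level t hτ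
  · intro σ hσ
    rw [Subgroup.mem_pointwise_smul_iff_inv_smul_mem, ← map_inv]
    exact scale_mem_level t⁻¹ hσ

/-- The torus as a group of automorphisms preserving the stabilizers of the depths. It is a section
of `diagPart`. -/
def torusLevelAut (p n : ℕ) [Fact p.Prime] : (Fin n → ZMod p)ˣ →* levelAut p n :=
  (torus p n).codRestrict _ torus_mem_levelAut

theorem diagPart_torus (t : (Fin n → ZMod p)ˣ) : diagPart p n (torusLevelAut p n t) = t := by
  ext k
  rw [diagPart_apply]
  change total k (scale t (levelGen p k)) = _
  rw [total_eq, blockSum_scale, smul_zero]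
  change _ * total k (levelGen p k) = _
  rw [total_levelGen, mul_one]

/-- An automorphism `β` of prime order `q ≠ p` with trivial diagonal part permutes, for each `k`,
the elements of `level p n k` with sum of labels `1` at depth `k`. Their number is a power of `p`,
so that one of them is fixed. Hence the fixed points of `β` generate the group modulo commutators.
-/
theorem isPGroup_ker_diagPart : IsPGroup p (diagPart p n).ker := by
  have : Finite (MulAut (treeGroup p n)) := inferInstance
  refine IsPGroup.of_card
    (Nat.eq_prime_pow_of_unique_prime_dvd Nat.card_pos.ne' fun {q} hq hqd => ?_)
  have : Fact q.Prime := ⟨hq⟩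
  obtain ⟨β, hβ⟩ := exists_prime_orderOf_dvd_card' q hqd
  by_contra hqp
  have hP := isPGroup_treeGroup p n
  let β' : MulAut (treeGroup p n) := β.1.1
  have hβ' : orderOf β' = q := by
    rw [← hβ, ← Subgroup.orderOf_coe, ← Subgroup.orderOf_coe]
  let C : Subgroup (treeGroup p n) :=
    β'.toMonoidHom.eqLocus (MonoidHom.id _)
  have h1 : ∀ k : Fin n, ∃ d ∈ level p n k, d ∈ C ∧ total k d = 1 := by
    intro k
    let S : SubMulAction (Subgroup.zpowers β') (treeGroup p n) :=
      { carrier := {d | d ∈ level p n k ∧ total k d = 1}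
        smul_mem' := by
          rintro ⟨_, m, rfl⟩ d ⟨hd, hd1⟩
          have hm : diagPart p n (β.1 ^ m) = 1 := by
            rw [map_zpow, MonoidHom.mem_ker.1 β.2, one_zpow]
          have hmem : β' ^ m ∈ levelAut p n := zpow_mem β.1.2 m
          refine ⟨apply_mem_level hmem hd, (total_apply hmem hd).trans ?_⟩
          rw [hd1, mul_one]
          exact congrFun (congrArg Units.val hm) k }
    have hSq : ¬ q ∣ Nat.card S := by
      let L : Subgroup (treeGroup p n) := level p n k ⊓ (totalSum p n k).ker
      have hL : ∀ {d}, d ∈ L ↔ d ∈ level p n k ∧ total k d = 0 := Iff.rfl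
      let e : S ≃ L :=
        { toFun := fun d => ⟨(levelGen p k)⁻¹ * d.1, hL.2
            ⟨mul_mem (inv_mem (levelGen_mem k)) d.2.1, by
              rw [total_mul, total_inv, total_levelGen, d.2.2, neg_add_cancel]⟩⟩
          invFun := fun d => ⟨levelGen p k * d.1, mul_mem (levelGen_mem k) d.2.1, by
            rw [total_mul, total_levelGen, (hL.1 d.2).2, add_zero]⟩
          left_inv := fun d => Subtype.ext (mul_inv_cancel_left _ _)
          right_inv := fun d => Subtype.ext (inv_mul_cancel_left _ _) }
      rw [Nat.card_congr e]
      intro h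
      have := h.trans (Subgroup.card_subgroup_dvd_card L)
      rw [card_treeGroup] at this
      exact hqp ((Nat.prime_dvd_prime_iff_eq hq Fact.out).1 (hq.dvd_of_dvd_pow this))
    have hz : IsPGroup q (Subgroup.zpowers β') := IsPGroup.of_card (n := 1) (by
      rw [Nat.card_zpowers, hβ', pow_one])
    obtain ⟨⟨d, hd⟩, hfix⟩ := hz.nonempty_fixed_point_of_prime_not_dvd_card S hSq
    exact ⟨d, hd.1, congrArg Subtype.val (hfix ⟨β', Subgroup.mem_zpowers β'⟩), hd.2⟩
  have h2 : C ⊔ commutator (treeGroup p n) = ⊤ := by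
    refine eq_top_iff.2 fun σ _ => ?_
    have h3 : ∀ k ≤ n, ∃ c ∈ C, ∀ i : Fin n, i < k → total i (c * σ) = 0 := by
      intro k
      induction k with
      | zero => exact fun _ => ⟨1, one_mem _, fun i hi => absurd hi (Nat.not_lt_zero _)⟩
      | succ k ih =>
        intro hk
        obtain ⟨c, hc, hc'⟩ := ih (k.le_succ.trans hk)
        obtain ⟨d, hd, hdC, hd1⟩ := h1 ⟨k, hk⟩
        refine ⟨(d ^ (total ⟨k, hk⟩ (c * σ)).val)⁻¹ * c, mul_mem (inv_mem (pow_mem hdC _)) hc,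
          fun i hi => ?_⟩
        rw [mul_assoc, total_mul, total_inv, total_pow, ZMod.natCast_zmod_val]
        rcases Nat.lt_succ_iff_lt_or_eq.1 hi with hi' | hi'
        · rw [hc' i hi', total_of_mem_level hi' hd, mul_zero, neg_zero, zero_add]
        · obtain rfl : i = ⟨k, hk⟩ := Fin.ext hi'
          rw [hd1, mul_one, neg_add_cancel]
    obtain ⟨c, hc, hc'⟩ := h3 n le_rfl
    rw [← inv_mul_cancel_left c σ]
    exact Subgroup.mul_mem_sup (inv_mem hc) (mem_commutator_of_total fun i => hc' i i.2)
  have : Group.IsNilpotent (treeGroup p n) := hP.isNilpotent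
  have h3 := eq_top_of_sup_commutator_eq_top h2
  have h4 : β' = 1 := MulEquiv.ext fun σ => (h3 ▸ Subgroup.mem_top σ : σ ∈ C)
  rw [h4, orderOf_one] at hβ'
  exact hq.one_lt.ne hβ'

/-- Up to conjugation by an automorphism, every action of a `p'`-group on `treeGroup p n` is through
the torus. -/
theorem exists_conj_torus {G : Type*} [Group G] [Finite G] (hG : ¬ p ∣ Nat.card G)
    (φ : G →* MulAut (treeGroup p n)) :
    ∃ (κ : MulAut (treeGroup p n)) (t : G →* (Fin n → ZMod p)ˣ),
      ∀ g, φ g = κ⁻¹ * torus p n (t g) * κ := by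
  let φ' : G →* levelAut p n := φ.codRestrict _ fun g =>
    Subgroup.mem_iInf.2 fun k => smul_level_eq hG φ k g
  obtain ⟨κ, -, hκ⟩ := exists_conj_of_isPGroup hG (φ := φ')
    (t := (torusLevelAut p n).comp ((diagPart p n).comp φ')) isPGroup_ker_diagPart fun g => by
      rw [MonoidHom.mem_ker, map_mul, map_inv, MonoidHom.comp_apply, diagPart_torus]
      exact mul_inv_cancel _
  exact ⟨κ, (diagPart p n).comp φ', fun g => congrArg Subtype.val (hκ g)⟩

end automorphism

/-! ### Direct summands of multiples of a transitive permutation module -/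

section permutationModule

variable {K Ω E : Type*} [Field K] [AddCommGroup E] [Module K E]

/-- The values of the constant functions in `Y`. If a group permutes `Ω` transitively, these are the
fixed points of that group in `Y`. -/
def constPart (Y : Submodule K (Ω → E)) : Submodule K E :=
  Y.comap (LinearMap.pi fun _ => LinearMap.id)

theorem mem_constPart {Y : Submodule K (Ω → E)} {c : E} : c ∈ constPart Y ↔ (fun _ => c) ∈ Y :=
  Iff.rfl

/-- The functions with values in `F`. -/
def valuedIn (Ω : Type*) (F : Submodule K E) : Submodule K (Ω → E) :=
  LinearMap.range (F.subtype.compLeft Ω)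

theorem mem_valuedIn {F : Submodule K E} {m : Ω → E} : m ∈ valuedIn Ω F ↔ ∀ v, m v ∈ F := by
  refine ⟨?_, fun h => ⟨fun v => ⟨m v, h v⟩, rfl⟩⟩
  rintro ⟨f, rfl⟩ v
  exact (f v).2

theorem finrank_valuedIn [Finite Ω] [FiniteDimensional K E] (F : Submodule K E) :
    Module.finrank K (valuedIn Ω F) = Nat.card Ω * Module.finrank K F := by
  have : Fintype Ω := Fintype.ofFinite Ω
  rw [valuedIn, LinearMap.finrank_range_of_inj, Module.finrank_pi_fintype]
  · simp
  · intro f g h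
    funext v
    exact Subtype.ext (congrFun h v)

variable {H : Type*} [Group H] [MulAction H Ω]

/-- `Y` is invariant under the permutations of the arguments by `H`. -/
def IsPermInvariant (H : Type*) [Group H] [MulAction H Ω] (Y : Submodule K (Ω → E)) : Prop :=
  ∀ (h : H), ∀ m ∈ Y, (fun v => m (h • v)) ∈ Y

theorem isCompl_constPart [MulAction.IsPretransitive H Ω] [Nonempty Ω]
    {N X : Submodule K (Ω → E)}
    (hN : IsPermInvariant H N) (hX : IsPermInvariant H X) (h : IsCompl N X) :
    IsCompl (constPart N) (constPart X) := by
  refine ⟨Submodule.disjoint_def.2 fun c hc hc' => ?_,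
    codisjoint_iff.2 (eq_top_iff.2 fun c _ => ?_)⟩
  · exact congrFun (Submodule.disjoint_def.1 h.disjoint _ hc hc') (Classical.arbitrary Ω)
  · obtain ⟨a, ha, b, hb, hab⟩ := Submodule.mem_sup.1
      (h.sup_eq_top ▸ Submodule.mem_top : (fun _ => c : Ω → E) ∈ N ⊔ X)
    have hinv : ∀ g : H, ∀ v, a (g • v) = a v := by
      intro g v
      have h1 : (fun v => a (g • v)) - a = b - fun v => b (g • v) := by
        funext w
        have h2 := congrFun hab (g • w)
        have h3 := congrFun hab w
        simp only [Pi.add_apply] at h2 h3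
        simp only [Pi.sub_apply]
        rw [sub_eq_sub_iff_add_eq_add, h2, add_comm, h3]
      have h2 : (fun v => a (g • v)) - a = 0 := Submodule.disjoint_def.1 h.disjoint _
        (sub_mem (hN g a ha) ha) (h1 ▸ sub_mem hb (hX g b hb))
      exact sub_eq_zero.1 (congrFun h2 v)
    let v := Classical.arbitrary Ω
    have hav : a = fun _ => a v := funext fun w => by
      obtain ⟨g, rfl⟩ := MulAction.exists_smul_eq H v w
      exact hinv g v
    have hbv : b = fun _ => b v := funext fun w => by
      have h2 := congrFun hab w
      have h3 := congrFun hab v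
      rw [Pi.add_apply, hav] at h2
      rw [← h3, Pi.add_apply] at h2
      exact add_left_cancel h2
    refine Submodule.mem_sup.2 ⟨a v, ?_, b v, ?_, congrFun hab v⟩
    · rw [mem_constPart, ← hav]; exact ha
    · rw [mem_constPart, ← hbv]; exact hb

end permutationModule

section modular

variable {p : ℕ} [Fact p.Prime] {Ω E H : Type*} [AddCommGroup E] [Module (ZMod p) E]
  [Finite E] [Finite Ω] [Group H] [MulAction H Ω] [MulAction.IsPretransitive H Ω]

/-- A nonzero module of a `p`-group over `F_p` has a nonzero fixed vector, which here is a constant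
function. -/
theorem disjoint_valuedIn (hH : IsPGroup p H) {Y : Submodule (ZMod p) (Ω → E)}
    (hY : IsPermInvariant H Y) {F : Submodule (ZMod p) E} (h : Disjoint (constPart Y) F) :
    Disjoint Y (valuedIn Ω F) := by
  rw [Submodule.disjoint_def]
  by_contra! hcon
  obtain ⟨m, hmY, hmF, hm⟩ := hcon
  let _ : MulAction H (Ω → E) := arrowAction
  let S : SubMulAction H (Ω → E) :=
    { carrier := ↑(Y ⊓ valuedIn Ω F)
      smul_mem' := fun g f hf => ⟨hY g⁻¹ f hf.1, mem_valuedIn.2 fun v =>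
        mem_valuedIn.1 hf.2 (g⁻¹ • v)⟩ }
  have hS : p ∣ Nat.card S := by
    change p ∣ Nat.card (Y ⊓ valuedIn Ω F : Submodule _ _)
    have hnt : Nontrivial (Y ⊓ valuedIn Ω F : Submodule _ _) :=
      ⟨⟨m, hmY, hmF⟩, 0, fun h => hm (congrArg Subtype.val h)⟩
    have hpos := Module.finrank_pos (R := ZMod p) (M := (Y ⊓ valuedIn Ω F : Submodule _ _))
    rw [Module.natCard_eq_pow_finrank (K := ZMod p), Nat.card_zmod]
    exact dvd_pow_self p hpos.ne'
  obtain ⟨⟨b, hbY, hbF⟩, hb, hb0⟩ := hH.exists_fixed_point_of_prime_dvd_card_of_fixed_point S hS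
    (a := ⟨0, (Y ⊓ valuedIn Ω F).zero_mem⟩) (fun g => rfl)
  have hconst : ∀ v w, b v = b w := by
    intro v w
    obtain ⟨g, rfl⟩ := MulAction.exists_smul_eq H w v
    have := congrFun (congrArg Subtype.val (hb g)) (g • w)
    change b (g⁻¹ • g • w) = b (g • w) at this
    rw [← this, inv_smul_smul]
  refine hb0 (Subtype.ext (funext fun v => ?_))
  refine (Submodule.disjoint_def.1 h (b v) ?_ (mem_valuedIn.1 hbF v)).symm
  rw [mem_constPart]
  have hbv : (fun _ => b v) = b := funext fun w => hconst v w
  rw [hbv]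
  exact hbY

/-- If `N` is a direct summand of `Ω → E` as a module of a transitive `p`-group, every complement
`F` in `E` to the values of the constant functions in `N` gives the complement `Ω → F` to `N`. By
`disjoint_valuedIn`, both `N` and its given complement have at most the dimension that one reads
off their constants, so that there is equality. -/
theorem isCompl_valuedIn [Nonempty Ω] (hH : IsPGroup p H) {N X : Submodule (ZMod p) (Ω → E)}
    (hN : IsPermInvariant H N) (hX : IsPermInvariant H X) (h : IsCompl N X)
    {F : Submodule (ZMod p) E} (hF : IsCompl (constPart N) F) : IsCompl N (valuedIn Ω F) := by
  have hE := isCompl_constPart hN hX h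
  have h1 := Submodule.finrank_add_finrank_le_of_disjoint
    (disjoint_valuedIn hH hX hE.symm.disjoint)
  have h2 := Submodule.finrank_add_eq_of_isCompl h
  have h3 := Submodule.finrank_add_eq_of_isCompl hF
  have hM : Module.finrank (ZMod p) (Ω → E) = Nat.card Ω * Module.finrank (ZMod p) E := by
    have : Fintype Ω := Fintype.ofFinite Ω
    simp [Module.finrank_pi_fintype]
  have hd := disjoint_valuedIn hH hN hF.disjoint
  refine ⟨hd, codisjoint_iff.2 (Submodule.eq_top_of_disjoint _ _ ?_ hd)⟩
  rw [finrank_valuedIn] at h1 ⊢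
  rw [hM, ← h3, mul_add]
  omega

end modular

section maschke

open Representation

/-- Maschke's theorem, with the complement inside a prescribed invariant subspace `B`. -/
theorem exists_invariant_isCompl {K G V : Type*} [Field K] [Group G] [Finite G]
    [NeZero (Nat.card G : K)] [AddCommGroup V] [Module K V] (ρ : Representation K G V)
    {A B : Submodule K V} (hA : ∀ g, ∀ v ∈ A, ρ g v ∈ A) (hB : ∀ g, ∀ v ∈ B, ρ g v ∈ B)
    (h : A ⊔ B = ⊤) : ∃ F ≤ B, (∀ g, ∀ v ∈ F, ρ g v ∈ F) ∧ IsCompl A F := by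
  let A' : Subrepresentation ρ := ⟨A, hA⟩
  let B' : Subrepresentation ρ := ⟨B, hB⟩
  have hc : ComplementedLattice (Subrepresentation ρ) :=
    (inferInstance : IsSemisimpleRepresentation ρ)
  obtain ⟨F, hF⟩ := exists_isCompl (A' ⊓ B')
  have hinf : (A ⊓ B) ⊓ F.toSubmodule = ⊥ :=
    congrArg Subrepresentation.toSubmodule hF.inf_eq_bot
  have hsup : (A ⊓ B) ⊔ F.toSubmodule = ⊤ :=
    congrArg Subrepresentation.toSubmodule hF.sup_eq_top
  refine ⟨F.toSubmodule ⊓ B, inf_le_right,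
    fun g v hv => ⟨F.apply_mem_toSubmodule g hv.1, hB g v hv.2⟩, ?_, ?_⟩
  · rw [disjoint_iff, inf_comm F.toSubmodule, ← inf_assoc, hinf]
  · rw [codisjoint_iff, eq_top_iff, ← h]
    refine sup_le le_sup_left ?_
    calc B = ((A ⊓ B) ⊔ F.toSubmodule) ⊓ B := by rw [hsup, top_inf_eq]
      _ = (A ⊓ B) ⊔ F.toSubmodule ⊓ B := sup_inf_assoc_of_le _ inf_le_right
      _ ≤ A ⊔ F.toSubmodule ⊓ B := sup_le_sup_right inf_le_left _

end maschke

/-! ### Complements from linear algebra of block sums -/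

section words

variable {p n k : ℕ}

/-- The words of length `k`, encoded as words of length `n` that vanish from position `k` on. The
group `treeGroup p n` acts on them as on the prefixes of length `k`. -/
abbrev Word (p n k : ℕ) := {v : Fin n → ZMod p // ∀ j : Fin n, k ≤ j → v j = 0}

/-- The truncation of a word to a word of length `k`. -/
def toWord (k : ℕ) (x : Fin n → ZMod p) : Word p n k :=
  ⟨trunc k x, fun _ hj => trunc_apply_of_le hj x⟩

theorem toWord_coe (v : Word p n k) : toWord k v.1 = v := Subtype.ext (trunc_eq_self v.2)

theorem toWord_eq_iff {x y : Fin n → ZMod p} : toWord k x = toWord k y ↔ AgreeTo k x y := by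
  rw [← trunc_eq_iff]
  exact Subtype.ext_iff

instance : MulAction (treeGroup p n) (Word p n k) where
  smul σ v := toWord k (σ • v.1)
  one_smul v := by
    change toWord k ((1 : treeGroup p n) • v.1) = v
    rw [one_smul, toWord_coe]
  mul_smul σ τ v := by
    change toWord k ((σ * τ) • v.1) = toWord k (σ • trunc k (τ • v.1))
    rw [toWord_eq_iff, mul_smul, agreeTo_smul_iff]
    exact (agreeTo_trunc _ _).symm

theorem smul_word_coe (σ : treeGroup p n) (v : Word p n k) : (σ • v).1 = trunc k (σ • v.1) := rfl

instance : Nonempty (Word p n k) := ⟨⟨0, fun _ _ => rfl⟩⟩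

instance [NeZero p] : MulAction.IsPretransitive (treeGroup p n) (Word p n k) :=
  ⟨fun v w => by
    obtain ⟨σ, hσ⟩ := MulAction.exists_smul_eq (treeGroup p n) v.1 w.1
    refine ⟨σ, Subtype.ext ?_⟩
    rw [smul_word_coe, hσ, trunc_eq_self w.2]⟩

/-- The depths from `k` on. -/
abbrev LevelFrom (n k : ℕ) := {i : Fin n // k ≤ i}

/-- The elements that change only the first `k` letters: the standard complement to
`level p n k`. -/
def head (p n k : ℕ) : Subgroup (treeGroup p n) where
  carrier := {σ | ∀ (x : Fin n → ZMod p) (i : Fin n), k ≤ i → (σ • x) i = x i}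
  one_mem' := fun x i _ => by rw [one_smul]
  mul_mem' := fun {σ τ} hσ hτ x i hi => by rw [mul_smul, hσ _ i hi, hτ x i hi]
  inv_mem' := fun {σ} hσ x i hi => by rw [← hσ (σ⁻¹ • x) i hi, smul_inv_smul]

theorem mem_head {σ : treeGroup p n} :
    σ ∈ head p n k ↔ ∀ (x : Fin n → ZMod p) (i : Fin n), k ≤ i → (σ • x) i = x i := Iff.rfl

theorem mem_head_iff_label {σ : treeGroup p n} :
    σ ∈ head p n k ↔ ∀ i : Fin n, k ≤ i → ∀ x, label σ i x = 0 := by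
  simp only [mem_head, label, sub_eq_zero]
  exact ⟨fun h i hi x => h x i hi, fun h x i hi => h i hi x⟩

theorem scale_mem_head (t : (Fin n → ZMod p)ˣ) {σ : treeGroup p n} (h : σ ∈ head p n k) :
    scale t σ ∈ head p n k :=
  mem_head_iff_label.2 fun i hi x => by rw [label_scale, mem_head_iff_label.1 h i hi, mul_zero]

theorem eq_one_of_mem_head_of_mem_level {σ : treeGroup p n} (h : σ ∈ head p n k)
    (h' : σ ∈ level p n k) : σ = 1 := treeGroup_ext fun i x => by
  rw [label_one]
  rcases le_or_gt k i with hi | hi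
  · exact mem_head_iff_label.1 h i hi x
  · exact mem_level_iff_label.1 h' i hi x

theorem label_conj_head {h σ : treeGroup p n} (hh : h ∈ head p n k) {i : Fin n} (hi : k ≤ i)
    (x : Fin n → ZMod p) : label (h * σ * h⁻¹) i x = label σ i (h⁻¹ • x) := by
  rw [label, label, mul_smul, mul_smul, mem_head.1 hh _ i hi, mem_head.1 (inv_mem hh) _ i hi]

variable [Fact p.Prime]

/-- The image of `B ⊓ level p n k` under the block sums, a subspace of the module of all functions
from vertices at depth `k` to `(F_p)^{n-k}`. -/
noncomputable def blockImage (k : ℕ) (B : Subgroup (treeGroup p n)) :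
    Submodule (ZMod p) (Word p n k → LevelFrom n k → ZMod p) where
  carrier := {m | ∃ σ ∈ B, σ ∈ level p n k ∧ ∀ v i, blockSum k i.1 v.1 σ = m v i}
  zero_mem' := ⟨1, one_mem _, one_mem _, fun v i => blockSum_one _ _⟩
  add_mem' := by
    rintro _ _ ⟨σ, hσB, hσ, h⟩ ⟨τ, hτB, hτ, h'⟩
    refine ⟨σ * τ, mul_mem hσB hτB, mul_mem hσ hτ, fun v i => ?_⟩
    rw [blockSum_mul_of_mem i.2 _ _ hτ, h, h']
    rfl
  smul_mem' := by
    rintro c _ ⟨σ, hσB, hσ, h⟩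
    refine ⟨σ ^ c.val, pow_mem hσB _, pow_mem hσ _, fun v i => ?_⟩
    rw [blockSum_pow_of_mem i.2 _ hσ, h, ZMod.natCast_zmod_val]
    rfl

theorem mem_blockImage {B : Subgroup (treeGroup p n)} {m : Word p n k → LevelFrom n k → ZMod p} :
    m ∈ blockImage k B ↔ ∃ σ ∈ B, σ ∈ level p n k ∧ ∀ v i, blockSum k i.1 v.1 σ = m v i := Iff.rfl

/-- The family of all block sums of an element. -/
noncomputable def blockVec (k : ℕ) (σ : treeGroup p n) : Word p n k → LevelFrom n k → ZMod p :=
  fun v i => blockSum k i.1 v.1 σ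

theorem blockVec_mem {B : Subgroup (treeGroup p n)} {σ : treeGroup p n} (hB : σ ∈ B)
    (hσ : σ ∈ level p n k) : blockVec k σ ∈ blockImage k B := ⟨σ, hB, hσ, fun _ _ => rfl⟩

theorem exists_blockVec_eq (m : Word p n k → LevelFrom n k → ZMod p) :
    ∃ σ ∈ level p n k, blockVec k σ = m := by
  obtain ⟨σ, hσ, h⟩ := exists_blockSum_eq (p := p) (n := n) k
    fun v i => if hi : k ≤ i then m (toWord k v) ⟨i, hi⟩ else 0
  refine ⟨σ, hσ, funext fun v => funext fun i => ?_⟩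
  rw [blockVec, h i.1 i.2, dif_pos i.2, trunc_eq_self v.2, toWord_coe]

theorem blockVec_mul (σ : treeGroup p n) {τ : treeGroup p n} (hτ : τ ∈ level p n k) :
    blockVec k (σ * τ) = blockVec k σ + blockVec k τ :=
  funext fun _ => funext fun i => blockSum_mul_of_mem i.2 _ _ hτ

theorem blockVec_inv {τ : treeGroup p n} (hτ : τ ∈ level p n k) :
    blockVec k τ⁻¹ = - blockVec k τ :=
  funext fun _ => funext fun i => blockSum_inv_of_mem i.2 _ hτ

theorem blockSum_eq_zero_of_blockVec {σ : treeGroup p n} (h : blockVec k σ = 0) (i : Fin n)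
    (hi : k ≤ i) (v : Fin n → ZMod p) : blockSum k i v σ = 0 := by
  rw [blockSum_congr (agreeTo_trunc k v).symm]
  exact congrFun (congrFun h (toWord k v)) ⟨i, hi⟩

theorem blockVec_smul_conj {σ : treeGroup p n} (hσ : σ ∈ level p n k) (τ : treeGroup p n)
    (v : Word p n k) : blockVec k (τ * σ * τ⁻¹) (τ • v) = blockVec k σ v := by
  funext i
  rw [blockVec, blockVec, ← blockSum_conj i.2 v.1 hσ τ]
  exact blockSum_congr (agreeTo_trunc _ _) _

/-- `level p n k` acts trivially on the module of block sums, so that `B` needs to be normalized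
only modulo `level p n k`. -/
theorem blockImage_invariant_of_conj {B : Subgroup (treeGroup p n)}
    (h : ∀ τ : treeGroup p n, ∃ d ∈ level p n k, ∀ σ ∈ B, (d * τ) * σ * (d * τ)⁻¹ ∈ B) :
    IsPermInvariant (treeGroup p n) (blockImage k B) := by
  rintro τ m ⟨σ, hσB, hσ, hm⟩
  obtain ⟨d, hd, hB⟩ := h τ⁻¹
  refine ⟨_, hB σ hσB, (level_normal p n k).conj_mem σ hσ _, fun v i => ?_⟩
  change _ = m (τ • v) i
  rw [← hm]
  have h1 := congrFun (blockVec_smul_conj hσ (d * τ⁻¹) (τ • v)) i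
  have h2 : (d * τ⁻¹) • τ • v = v := by
    rw [mul_smul, inv_smul_smul]
    refine Subtype.ext ?_
    rw [smul_word_coe, trunc_eq_iff.2 (hd v.1), trunc_eq_self v.2]
  rw [h2] at h1
  exact h1

theorem exists_level_mul_head (k : ℕ) (σ : treeGroup p n) :
    ∃ d ∈ level p n k, ∃ h ∈ head p n k, σ = d * h := by
  let h : treeGroup p n := ofLabel (fun i x => if (i : ℕ) < k then label σ i x else 0)
    fun i x y hxy => by rw [label_congr σ hxy]
  refine ⟨σ * h⁻¹, mul_inv_mem_level_iff.2 fun x i hi => ?_, h,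
    mem_head_iff_label.2 fun i hi x => ?_, by group⟩
  · rw [smul_apply_eq, smul_apply_eq, label_ofLabel, if_pos hi]
  · rw [label_ofLabel, if_neg (not_lt.2 hi)]

/-- A subgroup `X` of `level p n k` that maps injectively onto a complement of the image of `N`
under the block sums, and is normalized by `head p n k`, extends to the complement `X * head p n k`
of `N`. -/
theorem exists_isComplement_of_isCompl {N X : Subgroup (treeGroup p n)} [N.Normal]
    (hN : N ≤ level p n k)
    (hker : ∀ σ ∈ level p n k, blockVec k σ = 0 → σ ∈ N)
    (hX : X ≤ level p n k) (hX0 : ∀ σ ∈ X, blockVec k σ = 0 → σ = 1)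
    (hXh : ∀ h ∈ head p n k, ∀ σ ∈ X, h * σ * h⁻¹ ∈ X)
    (hc : IsCompl (blockImage k N) (blockImage k X)) :
    ∃ C : Subgroup (treeGroup p n), (∀ c, c ∈ C ↔ ∃ x ∈ X, ∃ h ∈ head p n k, c = x * h) ∧
      N.IsComplement' C := by
  let C : Subgroup (treeGroup p n) :=
    { carrier := {c | ∃ x ∈ X, ∃ h ∈ head p n k, c = x * h}
      one_mem' := ⟨1, one_mem _, 1, one_mem _, (mul_one 1).symm⟩
      mul_mem' := by
        rintro _ _ ⟨x, hx, h, hh, rfl⟩ ⟨y, hy, g, hg, rfl⟩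
        exact ⟨x * (h * y * h⁻¹), mul_mem hx (hXh h hh y hy), h * g, mul_mem hh hg, by group⟩
      inv_mem' := by
        rintro _ ⟨x, hx, h, hh, rfl⟩
        exact ⟨h⁻¹ * x⁻¹ * h⁻¹⁻¹, hXh h⁻¹ (inv_mem hh) _ (inv_mem hx), h⁻¹, inv_mem hh, by group⟩ }
  refine ⟨C, fun c => Iff.rfl, Subgroup.isComplement'_of_disjoint_and_mul_eq_univ ?_ ?_⟩
  · rw [Subgroup.disjoint_def]
    rintro _ hcN ⟨x, hx, h, hh, rfl⟩
    have h1 : h = 1 := eq_one_of_mem_head_of_mem_level hh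
      ((Subgroup.mul_mem_cancel_left _ (hX hx)).1 (hN hcN))
    rw [h1, mul_one] at hcN ⊢
    exact hX0 x hx (Submodule.disjoint_def.1 hc.disjoint _ (blockVec_mem hcN (hN hcN))
      (blockVec_mem hx (hX hx)))
  · refine Set.eq_univ_of_forall fun σ => ?_
    obtain ⟨d, hd, h, hh, rfl⟩ := exists_level_mul_head k σ
    obtain ⟨_, ⟨a, haN, ha, ha'⟩, _, ⟨x, hxX, hx, hx'⟩, hax⟩ := Submodule.mem_sup.1
      (hc.sup_eq_top ▸ Submodule.mem_top : blockVec k d ∈ _)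
    have hzero : blockVec k (d * x⁻¹ * a⁻¹) = 0 := by
      rw [blockVec_mul _ (inv_mem ha), blockVec_mul _ (inv_mem hx), blockVec_inv ha,
        blockVec_inv hx, ← hax]
      funext v i
      simp only [Pi.add_apply, Pi.neg_apply, Pi.zero_apply, blockVec, ← ha', ← hx']
      ring
    have h1 := hker _ (mul_mem (mul_mem hd (inv_mem hx)) (inv_mem ha)) hzero
    refine Set.mem_mul.2 ⟨_, mul_mem h1 haN, x * h, ⟨x, hxX, h, hh, rfl⟩, ?_⟩
    group

end words

/-! ### Combs -/

section comb

variable {p n k : ℕ}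

/-- The prefix of length `i` of `x` has the form `v0…0a` with `v` of length `k` and `a ≠ 0`. No such
prefix is a proper prefix of another one, so that rotations at these vertices commute. -/
def IsComb (k : ℕ) (i : Fin n) (x : Fin n → ZMod p) : Prop :=
  ∃ m : Fin n, (m : ℕ) + 1 = i ∧ k ≤ m ∧ x m ≠ 0 ∧ ∀ j : Fin n, k ≤ j → j < m → x j = 0

theorem IsComb.congr {i : Fin n} {x y : Fin n → ZMod p}
    (h : ∀ j : Fin n, k ≤ j → j < i → (x j = 0 ↔ y j = 0)) : IsComb k i x ↔ IsComb k i y := by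
  refine exists_congr fun m => and_congr_right fun hm => and_congr_right fun hk => ?_
  have hmi : m < i := by rw [Fin.lt_def]; omega
  refine (and_congr_left' (not_congr (h m hk hmi))).trans ?_
  exact and_congr_right fun _ => forall_congr' fun j => imp_congr_right fun hj =>
    imp_congr_right fun hjm => h j hj (hjm.trans hmi)

theorem not_isComb_of_zero {i : Fin n} {x : Fin n → ZMod p}
    (h : ∀ j : Fin n, k ≤ j → (j : ℕ) + 1 = i → x j = 0) : ¬ IsComb k i x :=
  fun ⟨m, hm, hk, hx, _⟩ => hx (h m hk hm)

variable [NeZero p]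

open Classical in
/-- The element with the label `-c v i` at all vertices `v0…0a` of depth `i` with `a ≠ 0`, and `0`
at all other vertices. As there are `p - 1` such vertices for each `v` and `i > k`, the block sum
at depth `i` is `c v i`. Taking all `a ≠ 0` instead of one makes the family of these elements
invariant under the torus. -/
noncomputable def comb (c : Word p n k → LevelFrom n k → ZMod p) : treeGroup p n :=
  ofLabel (fun i x =>
      if h : k ≤ i then (if IsComb k i x then - c (toWord k x) ⟨i, h⟩ else 0) else 0)
    fun i x y hxy => by
      by_cases h : k ≤ i
      · have h1 : IsComb k i x ↔ IsComb k i y := IsComb.congr fun j _ hj => by rw [hxy j hj]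
        rw [dif_pos h, dif_pos h, toWord_eq_iff.2 (hxy.mono h)]
        exact if_congr h1 rfl rfl
      · rw [dif_neg h, dif_neg h]

open Classical in
theorem label_comb (c : Word p n k → LevelFrom n k → ZMod p) {i : Fin n} (hi : k ≤ i)
    (x : Fin n → ZMod p) :
    label (comb c) i x = if IsComb k i x then - c (toWord k x) ⟨i, hi⟩ else 0 := by
  rw [comb, label_ofLabel, dif_pos hi]

theorem comb_mem_level (c : Word p n k → LevelFrom n k → ZMod p) : comb c ∈ level p n k :=
  mem_level_iff_label.2 fun i hi x => by rw [comb, label_ofLabel, dif_neg (not_le.2 hi)]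

theorem comb_smul_agreeTo (c : Word p n k → LevelFrom n k → ZMod p) {l : ℕ}
    {x : Fin n → ZMod p} (h : ∀ j : Fin n, k ≤ j → (j : ℕ) + 1 < l → x j = 0) :
    AgreeTo l (comb c • x) x := by
  rw [smul_agreeTo_iff]
  intro i hi
  by_cases hk : k ≤ i
  · rw [label_comb c hk, if_neg (not_isComb_of_zero fun j hj hji => h j hj (by omega))]
  · exact mem_level_iff_label.1 (comb_mem_level c) i (not_le.1 hk) x

theorem zero_of_comb_smul (c : Word p n k → LevelFrom n k → ZMod p) {l : ℕ}
    {x : Fin n → ZMod p} (h : ∀ j : Fin n, k ≤ j → (j : ℕ) + 1 < l → (comb c • x) j = 0) :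
    ∀ j : Fin n, k ≤ j → (j : ℕ) + 1 < l → x j = 0 := by
  induction l with
  | zero => exact fun j _ hj => absurd hj (Nat.not_lt_zero _)
  | succ l ih =>
    have h1 := comb_smul_agreeTo c (ih fun j hj hjl => h j hj (hjl.trans l.lt_succ_self))
    intro j hj hjl
    rw [← h1 j (Nat.lt_of_succ_lt_succ hjl)]
    exact h j hj hjl

theorem isComb_comb_smul (c : Word p n k → LevelFrom n k → ZMod p) (i : Fin n)
    (x : Fin n → ZMod p) : IsComb k i (comb c • x) ↔ IsComb k i x := by
  have key : (∀ j : Fin n, k ≤ j → (j : ℕ) + 1 < i → x j = 0) →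
      (IsComb k i (comb c • x) ↔ IsComb k i x) := fun h =>
    IsComb.congr fun j _ hj => by rw [comb_smul_agreeTo c h j hj]
  constructor
  · intro h
    refine (key (zero_of_comb_smul c fun j hj hji => ?_)).1 h
    obtain ⟨m, hm, _, _, h0⟩ := h
    exact h0 j hj (by rw [Fin.lt_def]; omega)
  · intro h
    refine (key fun j hj hji => ?_).2 h
    obtain ⟨m, hm, _, _, h0⟩ := h
    exact h0 j hj (by rw [Fin.lt_def]; omega)

theorem comb_add (c d : Word p n k → LevelFrom n k → ZMod p) :
    comb (c + d) = comb c * comb d := by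
  classical
  refine treeGroup_ext fun i x => ?_
  by_cases hi : k ≤ i
  · rw [label_mul, label_comb _ hi, label_comb _ hi, label_comb _ hi,
      toWord_eq_iff.2 (comb_mem_level d x)]
    rw [if_congr (isComb_comb_smul d i x) rfl rfl]
    by_cases h : IsComb k i x
    · simp only [if_pos h, Pi.add_apply, neg_add]
    · simp only [if_neg h, add_zero]
  · rw [mem_level_iff_label.1 (comb_mem_level _) i (not_le.1 hi), mem_level_iff_label.1
      (mul_mem (comb_mem_level c) (comb_mem_level d)) i (not_le.1 hi)]

theorem comb_zero : comb (0 : Word p n k → LevelFrom n k → ZMod p) = 1 := by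
  have := comb_add (0 : Word p n k → LevelFrom n k → ZMod p) 0
  rwa [add_zero, right_eq_mul] at this

theorem comb_neg (c : Word p n k → LevelFrom n k → ZMod p) : comb (-c) = (comb c)⁻¹ := by
  rw [eq_inv_iff_mul_eq_one, ← comb_add, neg_add_cancel, comb_zero]

theorem head_conj_comb {h : treeGroup p n} (hh : h ∈ head p n k)
    (c : Word p n k → LevelFrom n k → ZMod p) :
    h * comb c * h⁻¹ = comb fun v => c (h⁻¹ • v) := by
  classical
  refine treeGroup_ext fun i x => ?_
  by_cases hi : k ≤ i
  · rw [label_conj_head hh hi, label_comb c hi, label_comb _ hi]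
    have h1 : IsComb k i (h⁻¹ • x) ↔ IsComb k i x :=
      IsComb.congr fun j hj _ => by rw [mem_head.1 (inv_mem hh) x j hj]
    have h2 : toWord k (h⁻¹ • x) = h⁻¹ • toWord k x := by
      change _ = toWord k (h⁻¹ • trunc k x)
      rw [toWord_eq_iff, agreeTo_smul_iff]
      exact (agreeTo_trunc _ _).symm
    rw [h2]
    exact if_congr h1 rfl rfl
  · have h1 := (level_normal p n k).conj_mem _ (comb_mem_level c) h
    rw [mem_level_iff_label.1 h1 i (not_le.1 hi), mem_level_iff_label.1
      (comb_mem_level _) i (not_le.1 hi)]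

theorem scale_comb (t : (Fin n → ZMod p)ˣ) (c : Word p n k → LevelFrom n k → ZMod p) :
    scale t (comb c) = comb fun v i => t.val i.1 * c (toWord k (t⁻¹ • v.1)) i := by
  classical
  refine treeGroup_ext fun i x => ?_
  have hunit : ∀ (s : (Fin n → ZMod p)ˣ) (x : Fin n → ZMod p) (j : Fin n), x j = 0 →
      (s • x) j = 0 := fun s x j h => by simp [Units.smul_def, h]
  by_cases hi : k ≤ i
  · rw [label_scale, label_comb c hi, label_comb _ hi]
    have h1 : IsComb k i (t⁻¹ • x) ↔ IsComb k i x :=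
      IsComb.congr fun j _ _ => ⟨fun h => by
        simpa using hunit t _ j h, hunit _ _ j⟩
    have h2 : toWord k (t⁻¹ • (toWord k x).1) = toWord k (t⁻¹ • x) :=
      toWord_eq_iff.2 (agreeTo_units_smul _ (agreeTo_trunc _ _))
    rw [h2, mul_ite, mul_zero, mul_neg]
    exact if_congr h1 rfl rfl
  · rw [mem_level_iff_label.1 (scale_mem_level t (comb_mem_level c)) i (not_le.1 hi),
      mem_level_iff_label.1 (comb_mem_level _) i (not_le.1 hi)]

theorem blockSum_comb [Fact p.Prime] (c : Word p n k → LevelFrom n k → ZMod p) (v : Word p n k)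
    {i : LevelFrom n k} (hi : k < i.1) : blockSum k i.1 v.1 (comb c) = c v i := by
  classical
  let m : Fin n := ⟨i.1 - 1, by omega⟩
  have hm : (m : ℕ) + 1 = i.1 := by simp only [m]; omega
  have hkm : k ≤ m := by omega
  have h1 : blockSum k i.1 v.1 (comb c) =
      ∑ x ∈ (block k i.1 v.1).filter (IsComb k i.1), - c v i := by
    rw [blockSum, Finset.sum_filter]
    refine Finset.sum_congr rfl fun x hx => ?_
    rw [label_comb c i.2, toWord_eq_iff.2 (mem_block.1 hx).1, toWord_coe]
  have h2 : ∑ x ∈ (block k i.1 v.1).filter (IsComb k i.1), - c v i =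
      ∑ a ∈ Finset.univ.erase (0 : ZMod p), - c v i := by
    refine Finset.sum_nbij' (fun x => x m) (fun a => Function.update v.1 m a) ?_ ?_ ?_ ?_
      (fun _ _ => rfl)
    · intro x hx
      obtain ⟨m', hm', _, hx', _⟩ := (Finset.mem_filter.1 hx).2
      obtain rfl : m' = m := Fin.ext (by omega)
      exact Finset.mem_erase.2 ⟨hx', Finset.mem_univ _⟩
    · intro a ha
      refine Finset.mem_filter.2 ⟨mem_block.2 ⟨fun j hj => ?_, fun j hj => ?_⟩, m, hm, hkm, ?_,
        fun j hj hjm => ?_⟩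
      · rw [Function.update_of_ne]
        rintro rfl
        omega
      · rw [Function.update_of_ne]
        · exact v.2 j (by omega)
        · rintro rfl
          omega
      · rw [Function.update_self]
        exact (Finset.mem_erase.1 ha).1
      · rw [Function.update_of_ne hjm.ne]
        exact v.2 j hj
    · intro x hx
      obtain ⟨hx, m', hm', _, hx', h0⟩ := Finset.mem_filter.1 hx
      obtain rfl : m' = m := Fin.ext (by omega)
      rw [mem_block] at hx
      funext j
      by_cases hj : j = m
      · rw [hj, Function.update_self]
      rw [Function.update_of_ne hj]
      have hj' : (j : ℕ) ≠ m := fun h => hj (Fin.ext h)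
      rcases lt_or_ge (j : ℕ) k with hjk | hjk
      · exact (hx.1 j hjk).symm
      · rw [v.2 j hjk]
        rcases lt_or_ge (j : ℕ) i.1 with hji | hji
        · exact (h0 j hjk (by rw [Fin.lt_def]; omega)).symm
        · exact (hx.2 j hji).symm
    · intro a _
      exact Function.update_self _ _ _
  rw [h1, h2, Finset.sum_const, Finset.card_erase_of_mem (Finset.mem_univ _), Finset.card_univ,
    ZMod.card, nsmul_eq_mul, Nat.cast_sub (Fact.out : p.Prime).one_le]
  simp

theorem blockSum_comb_self (c : Word p n k → LevelFrom n k → ZMod p) (v : Word p n k)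
    {i : LevelFrom n k} (hi : (i.1 : ℕ) = k) : blockSum k i.1 v.1 (comb c) = 0 :=
  Finset.sum_eq_zero fun x _ => by
    rw [label_comb c i.2, if_neg]
    rintro ⟨m, hm, hkm, -⟩
    omega

end comb

/-! ### The invariant complement -/

section main

open scoped Pointwise

variable {p n : ℕ} [Fact p.Prime]

/-- The theorem for actions through the torus. -/
theorem exists_scale_invariant_complement {G : Type*} [Group G] [Finite G]
    (hG : ¬ p ∣ Nat.card G) (t : G →* (Fin n → ZMod p)ˣ) {N L : Subgroup (treeGroup p n)}
    [N.Normal] (hN : ∀ g, ∀ x ∈ N, scale (t g) x ∈ N) (hL : N.IsComplement' L) :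
    ∃ C : Subgroup (treeGroup p n), (∀ g, ∀ x ∈ C, scale (t g) x ∈ C) ∧ N.IsComplement' C := by
  classical
  by_cases hbot : N = ⊥
  · subst hbot
    exact ⟨⊤, fun _ _ _ => Subgroup.mem_top _, Subgroup.isComplement'_bot_top⟩
  -- `k` is the last depth whose stabilizer contains `N`.
  obtain ⟨k, hkn, hNk, hNk'⟩ : ∃ k, ∃ _ : k < n, N ≤ level p n k ∧ ¬ N ≤ level p n (k + 1) := by
    by_contra! hcon
    have : ∀ k ≤ n, N ≤ level p n k := by
      intro k
      induction k with
      | zero => intro _; rw [level_zero]; exact le_top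
      | succ k ih => exact fun hk => hcon k hk (ih (k.le_succ.trans hk))
    exact hbot (eq_bot_iff.2 (level_self (p := p) (n := n) ▸ this n le_rfl))
  let k' : LevelFrom n k := ⟨⟨k, hkn⟩, le_rfl⟩
  obtain ⟨y, hyN, hy⟩ := SetLike.not_le_iff_exists.1 hNk'
  obtain ⟨v₀, hv₀⟩ := not_forall.1 (mt (mem_level_succ_iff hkn (hNk hyN)).2 hy)
  -- So `N` is determined by its image in the module of block sums.
  have hker : ∀ σ ∈ level p n k, blockVec k σ = 0 → σ ∈ N := by
    intro σ hσ h0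
    refine (QuotientGroup.eq_one_iff (N := N) σ).1 (map_eq_one_of_blockSum
      (π := QuotientGroup.mk' N) (fun a ha b hb => ?_) hσ (blockSum_eq_zero_of_blockVec h0))
    exact commute_map_of_mem_level _ hkn (hNk hyN) hv₀ ((QuotientGroup.eq_one_iff _).2 hyN) ha hb
  have hNL : ∀ σ : treeGroup p n, ∃ a ∈ N, ∃ l ∈ L, a * l = σ := fun σ => by
    obtain ⟨a, ha, l, hl, h⟩ := Set.mem_mul.1 (hL.mul_eq.symm ▸ Set.mem_univ σ :
      σ ∈ (N : Set (treeGroup p n)) * (L : Set (treeGroup p n)))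
    exact ⟨a, ha, l, hl, h⟩
  set X := L ⊓ level p n k with hX
  have hdisj : ∀ x ∈ N, x ∈ L → x = 1 := fun x hx hx' =>
    Subgroup.disjoint_def.1 hL.disjoint hx hx'
  -- By the modular law, `L ⊓ level p n k` is a complement to `N` in `level p n k`.
  have hcompl : IsCompl (blockImage k N) (blockImage k X) := by
    refine ⟨Submodule.disjoint_def.2 ?_, codisjoint_iff.2 (eq_top_iff.2 fun m _ => ?_)⟩
    · rintro m ⟨a, haN, ha, ham⟩ ⟨x, hxX, hx, hxm⟩
      have hxN : x ∈ N := by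
        refine (Subgroup.mul_mem_cancel_left N (inv_mem haN)).1
          (hker _ (mul_mem (inv_mem ha) hx) ?_)
        rw [blockVec_mul _ hx, blockVec_inv ha]
        funext v i
        simp only [Pi.add_apply, Pi.neg_apply, Pi.zero_apply, blockVec, ham, hxm, neg_add_cancel]
      have := hdisj x hxN hxX.1
      funext v i
      rw [← hxm, this, blockSum_one]
      rfl
    · obtain ⟨σ, hσ, rfl⟩ := exists_blockVec_eq m
      obtain ⟨a, ha, l, hl, rfl⟩ := hNL σ
      have hlk : l ∈ level p n k := (Subgroup.mul_mem_cancel_left _ (hNk ha)).1 hσ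
      rw [blockVec_mul _ hlk]
      exact Submodule.add_mem_sup (blockVec_mem ha (hNk ha)) (blockVec_mem ⟨hl, hlk⟩ hlk)
  have hNinv : IsPermInvariant (treeGroup p n) (blockImage k N) :=
    blockImage_invariant_of_conj fun τ => ⟨1, one_mem _, fun σ hσ =>
      Subgroup.Normal.conj_mem inferInstance σ hσ _⟩
  have hXinv : IsPermInvariant (treeGroup p n) (blockImage k X) :=
    blockImage_invariant_of_conj fun τ => by
      obtain ⟨a, ha, l, hl, rfl⟩ := hNL τ
      refine ⟨a⁻¹, inv_mem (hNk ha), fun σ hσ => ?_⟩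
      rw [inv_mul_cancel_left]
      exact ⟨L.mul_mem (L.mul_mem hl hσ.1) (L.inv_mem hl), (level_normal p n k).conj_mem σ hσ.2 l⟩
  set E₁ := constPart (blockImage k N) with hE₁
  set E₂ := constPart (blockImage k X) with hE₂
  have hE : IsCompl E₁ E₂ := isCompl_constPart hNinv hXinv hcompl
  have hval : ∀ {F : Submodule (ZMod p) (LevelFrom n k → ZMod p)}, IsCompl E₁ F →
      IsCompl (blockImage k N) (valuedIn (Word p n k) F) := fun hF =>
    isCompl_valuedIn (isPGroup_treeGroup p n) hNinv hXinv hcompl hF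
  -- `X` has exponent `p`, because it embeds into an elementary abelian group.
  have hpow : ∀ c ∈ E₂, c k' ≠ 0 → ∀ i, i ≠ k' → c i = 0 := by
    rintro c ⟨x, hxX, hx, hxc⟩ hck i hi
    have hxp : x ^ p = 1 := by
      refine hdisj _ (hker _ (pow_mem hx p) ?_) (L.pow_mem hxX.1 p)
      funext v i
      simp [blockVec, blockSum_pow_of_mem i.2 _ hx]
    have hki : (⟨k, hkn⟩ : Fin n) < i.1 :=
      lt_of_le_of_ne i.2 fun h => hi (Subtype.ext h.symm)
    let v : Word p n k := Classical.arbitrary _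
    have h1 := blockSum_eq_zero_of_pow_eq_one hki hx hxp (v := v.1) (by
      rw [← blockSum_self (i := ⟨k, hkn⟩)]
      exact (hxc v k').trans_ne hck)
    exact (hxc v i).symm.trans h1
  let ρ : Representation (ZMod p) G (LevelFrom n k → ZMod p) :=
    { toFun := fun g =>
        { toFun := fun c i => (t g).val i.1 * c i
          map_add' := fun c d => funext fun i => mul_add _ _ _
          map_smul' := fun a c => funext fun i => mul_left_comm _ _ _ }
      map_one' := by ext; simp
      map_mul' := fun g h => by ext; simp [mul_assoc] }
  have hρ : ∀ g c i, ρ g c i = (t g).val i.1 * c i := fun _ _ _ => rfl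
  have hE₁inv : ∀ g, ∀ c ∈ E₁, ρ g c ∈ E₁ := by
    rintro g c ⟨σ, hσN, hσ, h⟩
    refine ⟨scale (t g) σ, hN g σ hσN, scale_mem_level _ hσ, fun v i => ?_⟩
    rw [blockSum_scale, blockSum_congr (agreeTo_trunc k _).symm]
    exact congrArg _ (h (toWord k ((t g)⁻¹ • v.1)) i)
  -- It remains to lift a suitable complement `F` of `E₁` to an invariant subgroup `Y`.
  suffices H : ∃ (F : Submodule (ZMod p) (LevelFrom n k → ZMod p)) (Y : Subgroup (treeGroup p n)),
      IsCompl E₁ F ∧ Y ≤ level p n k ∧ (∀ σ ∈ Y, blockVec k σ = 0 → σ = 1) ∧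
      (∀ h ∈ head p n k, ∀ σ ∈ Y, h * σ * h⁻¹ ∈ Y) ∧ (∀ g, ∀ σ ∈ Y, scale (t g) σ ∈ Y) ∧
      blockImage k Y = valuedIn (Word p n k) F by
    obtain ⟨F, Y, hF, hYk, hY0, hYh, hYs, hYF⟩ := H
    obtain ⟨C, hC, hNC⟩ := exists_isComplement_of_isCompl hNk hker hYk hY0 hYh (hYF ▸ hval hF)
    refine ⟨C, fun g c hc => ?_, hNC⟩
    obtain ⟨x, hx, h, hh, rfl⟩ := (hC c).1 hc
    refine (hC _).2 ⟨_, hYs g x hx, _, scale_mem_head (t g) hh, ?_⟩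
    exact map_mul (torus p n (t g)) x h
  by_cases htop : ∃ c ∈ E₂, c k' ≠ 0
  -- By `hpow`, either `E₂` consists of the vectors supported at depth `k`, and the rotations at
  -- depth `k` serve as `Y`, or it is contained in the space `E₀` of the vectors vanishing at
  -- depth `k`, which contains an invariant `F` that lifts to combs.
  · obtain ⟨c, hc, hck⟩ := htop
    have hE₂ : ∀ d, d ∈ E₂ ↔ ∀ i, i ≠ k' → d i = 0 := by
      refine fun d => ⟨fun hd i hi => ?_, fun hd => ?_⟩
      · by_cases hdk : d k' = 0
        · have := hpow (d + c) (add_mem hd hc) (by rwa [Pi.add_apply, hdk, zero_add]) i hi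
          rwa [Pi.add_apply, hpow c hc hck i hi, add_zero] at this
        · exact hpow d hd hdk i hi
      · have : d = (d k' / c k') • c := by
          funext i
          rw [Pi.smul_apply, smul_eq_mul]
          by_cases hi : i = k'
          · rw [hi, div_mul_cancel₀ _ hck]
          · rw [hd i hi, hpow c hc hck i hi, mul_zero]
        rw [this]
        exact E₂.smul_mem _ hc
    refine ⟨E₂, head p n (k + 1) ⊓ level p n k, hE, inf_le_right, fun σ hσ h0 => ?_,
      fun h hh σ hσ => ⟨?_, (level_normal p n k).conj_mem σ hσ.2 h⟩,
      fun g σ hσ => ⟨scale_mem_head _ hσ.1, scale_mem_level _ hσ.2⟩, ?_⟩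
    · refine eq_one_of_mem_head_of_mem_level hσ.1 ((mem_level_succ_iff hkn hσ.2).2 fun x => ?_)
      rw [← blockSum_self (i := ⟨k, hkn⟩)]
      exact blockSum_eq_zero_of_blockVec h0 ⟨k, hkn⟩ le_rfl x
    · have hh' : h ∈ head p n (k + 1) := fun x i hi => hh x i (k.le_succ.trans hi)
      exact Subgroup.mul_mem _ (Subgroup.mul_mem _ hh' hσ.1) (Subgroup.inv_mem _ hh')
    · ext m
      rw [mem_valuedIn, mem_blockImage]
      constructor
      · rintro ⟨σ, ⟨hσ, -⟩, -, h⟩ v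
        refine (hE₂ _).2 fun i hi => ?_
        rw [← h]
        refine Finset.sum_eq_zero fun x _ => mem_head_iff_label.1 hσ _ ?_ x
        exact Nat.lt_of_le_of_ne i.2 fun h => hi (Subtype.ext (Fin.ext h.symm))
      · intro hm
        let σ : treeGroup p n := rot ⟨k, hkn⟩ fun x => m (toWord k x) k'
        have hσ : σ ∈ level p n k := rot_mem_level ⟨k, hkn⟩ _
        have hlab : ∀ i : Fin n, i ≠ ⟨k, hkn⟩ → ∀ x, label σ i x = 0 := fun i hi x =>
          label_rot_of_ne hi _ x
        refine ⟨σ, ⟨mem_head_iff_label.2 fun i hi x => hlab i ?_ x, hσ⟩, hσ, fun v i => ?_⟩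
        · rintro rfl
          exact absurd hi (Nat.not_succ_le_self k)
        · by_cases hi : i = k'
          · subst hi
            refine (blockSum_self (i := ⟨k, hkn⟩) σ).trans ((label_rot_self _ _ _).trans ?_)
            rw [toWord_eq_iff.2 (agreeTo_trunc k v.1), toWord_coe]
          · rw [(hE₂ _).1 (hm v) i hi]
            exact Finset.sum_eq_zero fun x _ => hlab i.1 (fun h => hi (Subtype.ext h)) x
  · push Not at htop
    let E₀ : Submodule (ZMod p) (LevelFrom n k → ZMod p) := LinearMap.ker (LinearMap.proj k')
    have hE₀ : ∀ {c}, c ∈ E₀ ↔ c k' = 0 := Iff.rfl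
    have : NeZero (Nat.card G : ZMod p) := ⟨fun h => hG ((ZMod.natCast_eq_zero_iff _ _).1 h)⟩
    obtain ⟨F, hF₀, hFinv, hF⟩ := exists_invariant_isCompl ρ (A := E₁) (B := E₀) hE₁inv
      (fun g c hc => by rw [hE₀, hρ, hE₀.1 hc, mul_zero])
      (eq_top_iff.2 (hE.sup_eq_top ▸ sup_le_sup_left htop E₁))
    have hvec : ∀ m ∈ valuedIn (Word p n k) F, blockVec k (comb m) = m := by
      intro m hm
      funext v i
      by_cases hi : i = k'
      · rw [hi, hE₀.1 (hF₀ (mem_valuedIn.1 hm v))]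
        exact blockSum_comb_self m v rfl
      · exact blockSum_comb m v
          (Nat.lt_of_le_of_ne i.2 fun h => hi (Subtype.ext (Fin.ext h.symm)))
    let Y : Subgroup (treeGroup p n) :=
      { carrier := {σ | ∃ m ∈ valuedIn (Word p n k) F, comb m = σ}
        one_mem' := ⟨0, zero_mem _, comb_zero⟩
        mul_mem' := by
          rintro _ _ ⟨m, hm, rfl⟩ ⟨m', hm', rfl⟩
          exact ⟨m + m', add_mem hm hm', comb_add m m'⟩
        inv_mem' := by
          rintro _ ⟨m, hm, rfl⟩
          exact ⟨-m, neg_mem hm, comb_neg m⟩ }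
    refine ⟨F, Y, hF, ?_, ?_, ?_, ?_, ?_⟩
    · rintro _ ⟨m, -, rfl⟩
      exact comb_mem_level m
    · rintro _ ⟨m, hm, rfl⟩ h0
      rw [hvec m hm] at h0
      rw [h0, comb_zero]
    · rintro h hh _ ⟨m, hm, rfl⟩
      exact ⟨_, mem_valuedIn.2 fun v => mem_valuedIn.1 hm (h⁻¹ • v), (head_conj_comb hh m).symm⟩
    · rintro g _ ⟨m, hm, rfl⟩
      exact ⟨_, mem_valuedIn.2 fun v => hFinv g _ (mem_valuedIn.1 hm _), (scale_comb (t g) m).symm⟩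
    · ext m
      rw [mem_blockImage]
      constructor
      · rintro ⟨_, ⟨m', hm', rfl⟩, -, h⟩
        have : m' = m := by
          rw [← hvec m' hm']
          exact funext fun v => funext fun i => h v i
        exact this ▸ hm'
      · intro hm
        exact ⟨comb m, ⟨m, hm, rfl⟩, comb_mem_level m, fun v i =>
          congrFun (congrFun (hvec m hm) v) i⟩

end main

/-! ### Transfer to a Sylow subgroup -/

section transfer

open scoped Pointwise in
theorem isComplement'_map {V W : Type*} [Group V] [Group W] (e : V ≃* W) {N L : Subgroup V}
    (h : N.IsComplement' L) : (N.map e.toMonoidHom).IsComplement' (L.map e.toMonoidHom) := by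
  refine Subgroup.isComplement'_of_disjoint_and_mul_eq_univ ?_ (Set.eq_univ_of_forall fun w => ?_)
  · rw [disjoint_iff, ← Subgroup.map_inf _ _ _ e.injective, h.isCompl.inf_eq_bot,
      Subgroup.map_bot]
  · obtain ⟨a, ha, b, hb, hab⟩ := Set.mem_mul.1 (h.mul_eq.symm ▸ Set.mem_univ (e.symm w) :
      e.symm w ∈ (N : Set V) * (L : Set V))
    refine Set.mem_mul.2 ⟨e a, ⟨a, ha, rfl⟩, e b, ⟨b, hb, rfl⟩, ?_⟩
    rw [← map_mul, hab, MulEquiv.apply_symm_apply]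

theorem exists_invariant_complement_of_mulEquiv {G V W : Type*} [Group G] [Group V] [Group W]
    (e : V ≃* W) {φ : G →* MulAut V} {ψ : G →* MulAut W} (he : ∀ g v, e (φ g v) = ψ g (e v))
    (hW : ∀ N : Subgroup W, N.Normal → IsInvariantSubgroup ψ N → (∃ L, N.IsComplement' L) →
      ∃ C, IsInvariantSubgroup ψ C ∧ N.IsComplement' C)
    {N : Subgroup V} (hN : N.Normal) (hinv : IsInvariantSubgroup φ N)
    (hL : ∃ L, N.IsComplement' L) : ∃ C, IsInvariantSubgroup φ C ∧ N.IsComplement' C := by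
  obtain ⟨L, hL⟩ := hL
  have hinv' : IsInvariantSubgroup ψ (N.map e.toMonoidHom) := by
    rintro g _ ⟨x, hx, rfl⟩
    exact ⟨φ g x, hinv g x hx, he g x⟩
  obtain ⟨C, hC, hNC⟩ := hW (N.map e.toMonoidHom) (hN.map _ e.surjective) hinv'
    ⟨L.map e.toMonoidHom, isComplement'_map e hL⟩
  refine ⟨C.map e.symm.toMonoidHom, ?_, ?_⟩
  · rintro g _ ⟨x, hx, rfl⟩
    refine ⟨ψ g x, hC g x hx, ?_⟩
    change e.symm (ψ g x) = φ g (e.symm x)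
    rw [MulEquiv.symm_apply_eq, he, MulEquiv.apply_symm_apply]
  · have h := isComplement'_map e.symm hNC
    have h1 : (N.map e.toMonoidHom).map e.symm.toMonoidHom = N := by
      rw [Subgroup.map_map]
      convert Subgroup.map_id N
      ext x
      exact e.symm_apply_apply x
    rwa [h1] at h

theorem isPiGroup_of_isPGroup {p : ℕ} (hp : p.Prime) {V : Type*} [Group V] [Finite V]
    (hV : IsPGroup p V) : IsPiGroup {p} V := by
  refine ⟨inferInstance, fun q hq hqd => ?_⟩
  have : Fact p.Prime := ⟨hp⟩
  obtain ⟨m, hm⟩ := IsPGroup.iff_card.1 hV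
  rw [hm] at hqd
  exact (Nat.prime_dvd_prime_iff_eq hq hp).1 (hq.dvd_of_dvd_pow hqd)

end transfer

end TreeGroup

open TreeGroup in
theorem theorem1p2 (p : ℕ) (hp : p.Prime) (n : ℕ)
    (P : Sylow p (Equiv.Perm (Fin (p ^ n)))) :
    HasMaschkeProperty.{w} {p} P := by
  have : Fact p.Prime := ⟨hp⟩
  refine ⟨isPiGroup_of_isPGroup hp P.2, fun G _ φ hG N hN hinv hL => ?_⟩
  have hfin : Finite G := hG.1
  have hcard : ¬ p ∣ Nat.card G := fun h => hG.2 p hp h rfl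
  obtain ⟨e⟩ := nonempty_sylow_mulEquiv_treeGroup P
  obtain ⟨κ, t, hκ⟩ := exists_conj_torus hcard ((MulAut.congr e).toMonoidHom.comp φ)
  refine exists_invariant_complement_of_mulEquiv (e.trans κ) (ψ := (torus p n).comp t)
    (fun g v => ?_) (fun M hM hMinv ⟨L, hL⟩ => ?_) hN hinv hL
  · have h := DFunLike.congr_fun (hκ g) (e v)
    have h1 : e (φ g v) = κ⁻¹ (torus p n (t g) (κ (e v))) := by
      rw [← MulAut.mul_apply, ← MulAut.mul_apply, ← h]
      simp
    change κ (e (φ g v)) = _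
    rw [h1]
    simp
  · exact exists_scale_invariant_complement hcard t hMinv hL
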